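/- Write $(q_1,q_2,p_1,p_2)$ for the coordinates of $\mathbb{C}^4$ and put $I_1=q_2p_1-q_1p_2$, $I_2=\frac{q_1^2+q_2^2}{2}$, $I_3=\frac{p_1^2+p_2^2}{2}$. Let $H=-I_1+I_2+\eta I_3^2+F$, where $\eta\in\mathbb{C}\setminus\{0\}$ and $F:\mathcal{U}\to\mathbb{C}$ is a bounded analytic function on an open neighbourhood $\mathcal{U}$ of the origin in $\mathbb{C}^4$ whose Taylor series at $0$ contains only monomials of order at least $5$, when $q_1,q_2$ are given order $2$ and $p_1,p_2$ order $1$. Let $X_H=\left(\frac{\partial H}{\partial \mathbf{p}},-\frac{\partial H}{\partial \mathbf{q}}\right)$ be its Hamiltonian vector field and let $\mathcal{D}=\partial_\varphi+\partial_\tau$. A formal separatrix is a non-zero formal solution $\hat{\mathbf{\Gamma}}$ of $\mathcal{D}\mathbf{\Gamma}=X_H(\mathbf{\Gamma})$ of the form $(\tau^{-2}\hat\Gamma_1,\tau^{-2}\hat\Gamma_2,\tau^{-1}\hat\Gamma_3,\tau^{-1}\hat\Gamma_4)$, where each $\hat\Gamma_i$ is a formal power series in $\tau^{-1}$ whose coefficients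 are trigonometric polynomials in $\varphi$ with complex coefficients. Fix $h>0$ and $0<\theta<\frac{\pi}{4}$, and for $r>0$ let $$\mathbb{T}_h=\{\varphi\in\mathbb{C}/2\pi\mathbb{Z}:|\mathrm{Im}\,\varphi|<h\},\qquad D_r^-=\{\tau\in\mathbb{C}:|\arg(\tau+r)|>\theta\},\qquad D_r^+=-D_r^-.$$ For a series $\hat{\mathbf{\Gamma}}=\sum_{k\ge1}\mathbf{c}_k(\varphi)\tau^{-k}$, write $\mathbf{\Gamma}\sim\hat{\mathbf{\Gamma}}$ as $\tau\to\infty$ in $D$ if for every $N$ there are $C,R>0$ such that $\left|\mathbf{\Gamma}(\varphi,\tau)-\sum_{k=1}^N\mathbf{c}_k(\varphi)\tau^{-k}\right|\le C|\tau|^{-N-1}$ for all $\varphi\in\mathbb{T}_h$ and all $\tau\in D$ with $|\tau|>R$. **Theorem.** Given a formal separatrix $\hat{\mathbf{\Gamma}}$ of $X_H$, there exist $r_->0$ and a unique analytic function $\mathbf{\Gamma}^-:\mathbb{T}_h\times D^-_{r_-}\to\mathbb{C}^4$ with values in $\mathcal{U}$ that solves $\mathcal{D}\mathbf{\Gamma}^-=X_H(\mathbf{\Gamma}^-)$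 and satisfies $\mathbf{\Gamma}^-\sim\hat{\mathbf{\Gamma}}$ as $\tau\to\infty$ in $D^-_{r_-}$. Likewise, there exist $r_+>0$ and a unique analytic function $\mathbf{\Gamma}^+:\mathbb{T}_h\times D^+_{r_+}\to\mathbb{C}^4$ with values in $\mathcal{U}$ that solves $\mathcal{D}\mathbf{\Gamma}^+=X_H(\mathbf{\Gamma}^+)$ and satisfies $\mathbf{\Gamma}^+\sim\hat{\mathbf{\Gamma}}$ as $\tau\to\infty$ in $D^+_{r_+}$. -/

import Mathlib

open Set

noncomputable section

/-- The phase space `ℂ⁴`, with coordinates `(q₁, q₂, p₁, p₂) = (x 0, x 1, x 2, x 3)`. -/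
abbrev Phase : Type := Fin 4 → ℂ

/-- The weights of the coordinates: `q₁, q₂` have order `2` and `p₁, p₂` have order `1`. -/
def coordWeight : Fin 4 → ℕ := ![2, 2, 1, 1]

def I₁ (x : Phase) : ℂ := x 1 * x 2 - x 0 * x 3

def I₂ (x : Phase) : ℂ := (x 0 ^ 2 + x 1 ^ 2) / 2

def I₃ (x : Phase) : ℂ := (x 2 ^ 2 + x 3 ^ 2) / 2

/-- The Hamiltonian `H = -I₁ + I₂ + η I₃² + F`. -/
def hamiltonian (η : ℂ) (F : Phase → ℂ) (x : Phase) : ℂ :=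
  -I₁ x + I₂ x + η * I₃ x ^ 2 + F x

/-- The Taylor series of `F` at the origin contains only monomials of weighted order at least `m`:
every partial derivative at `0` that belongs to a monomial of smaller weighted order vanishes. -/
def HasWeightedOrderAtLeast (m : ℕ) (F : Phase → ℂ) : Prop :=
  ∀ (k : ℕ) (idx : Fin k → Fin 4), (∑ j, coordWeight (idx j)) < m →
    iteratedFDeriv ℂ k F 0 (fun j => Pi.single (idx j) 1) = 0

/-- The partial derivative of `H` in the direction of the `i`-th coordinate. -/
def coordDeriv (H : Phase → ℂ) (i : Fin 4) (x : Phase) : ℂ :=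
  fderiv ℂ H x (Pi.single i 1)

/-- The Hamiltonian vector field `X_H = (∂H/∂p, -∂H/∂q)`. -/
def hamVF (H : Phase → ℂ) (x : Phase) : Phase :=
  ![coordDeriv H 2 x, coordDeriv H 3 x, -coordDeriv H 0 x, -coordDeriv H 1 x]

/-- Trigonometric polynomials with complex coefficients. -/
def IsTrigPoly (f : ℂ → ℂ) : Prop :=
  ∃ (n : ℕ) (a b : ℕ → ℂ), ∀ φ : ℂ,
    f φ = a 0 + ∑ k ∈ Finset.Icc 1 n, a k * Complex.cos (k * φ)
      + ∑ k ∈ Finset.Icc 1 n, b k * Complex.sin (k * φ)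

/-- A formal series `∑ₖ c k φ τ⁻ᵏ` is given by its coefficients `c : ℕ → ℂ → ℂ⁴`. This is the
coefficient of `τ⁻ⁿ` in its image under `𝒟 = ∂_φ + ∂_τ`, where `∂_τ τ⁻ᵏ = -k τ⁻ᵏ⁻¹`. -/
def formalD (c : ℕ → ℂ → Phase) : ℕ → ℂ → Phase
  | 0, φ => deriv (c 0) φ
  | n + 1, φ => deriv (c (n + 1)) φ - (n : ℂ) • c n φ

/-- The coefficient of `τ⁻ⁿ` in the formal substitution of the series `∑ₖ≥₁ c k φ τ⁻ᵏ` into the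
Taylor series of `X` at `0`, that is, in
`∑ₗ (1/l!) DˡX(0)[∑ₖ c k φ τ⁻ᵏ, …, ∑ₖ c k φ τ⁻ᵏ]`: by multilinearity the `l`-th summand
contributes one term for each way to write `n` as an ordered sum of `l` positive integers. -/
def formalSubst (X : Phase → Phase) (c : ℕ → ℂ → Phase) (n : ℕ) (φ : ℂ) : Phase :=
  ∑ s : Composition n,
    ((s.length.factorial : ℂ))⁻¹ •
      iteratedFDeriv ℂ s.length X 0 (fun j => c (s.blocksFun j) φ)

/-- A formal separatrix of `X_H`: a non-zero formal solution of `𝒟Γ = X_H(Γ)` of the form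
`(τ⁻² Γ₁, τ⁻² Γ₂, τ⁻¹ Γ₃, τ⁻¹ Γ₄)`, where each `Γᵢ` is a formal power series in `τ⁻¹` whose
coefficients are trigonometric polynomials in `φ`. -/
structure IsFormalSeparatrix (H : Phase → ℂ) (c : ℕ → ℂ → Phase) : Prop where
  trig : ∀ (k : ℕ) (i : Fin 4), IsTrigPoly (fun φ => c k φ i)
  form : ∀ (k : ℕ) (i : Fin 4), k < coordWeight i → ∀ φ, c k φ i = 0
  ne_zero : ∃ (k : ℕ) (φ : ℂ), c k φ ≠ 0
  solves : ∀ (n : ℕ) (φ : ℂ), formalD c n φ = formalSubst (hamVF H) c n φ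

/-- The horizontal strip `|Im φ| < h`. Functions on `𝕋_h = {φ ∈ ℂ/2πℤ : |Im φ| < h}` are the
`2π`-periodic functions on this strip. -/
def strip (h : ℝ) : Set ℂ := {φ | |φ.im| < h}

/-- The sector `D⁻_r`. The vertex `-r` is not in it, as `Complex.arg 0 = 0`. -/
def sectorMinus (θ r : ℝ) : Set ℂ := {τ | θ < |Complex.arg (τ + r)|}

/-- The symmetric sector `D⁺_r = -D⁻_r`. -/
def sectorPlus (θ r : ℝ) : Set ℂ := {τ | -τ ∈ sectorMinus θ r}

/-- `Γ(φ, τ) ∼ ∑ₖ≥₁ c k φ τ⁻ᵏ` as `τ → ∞` in `D`, uniformly in `φ ∈ 𝕋_h`. -/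
def HasAsymptoticExpansion (h : ℝ) (D : Set ℂ) (Γ : ℂ × ℂ → Phase) (c : ℕ → ℂ → Phase) : Prop :=
  ∀ N : ℕ, ∃ C > 0, ∃ R > 0, ∀ φ ∈ strip h, ∀ τ ∈ D, R < ‖τ‖ →
    ‖Γ (φ, τ) - ∑ k ∈ Finset.Icc 1 N, (τ ^ k)⁻¹ • c k φ‖ ≤ C * (‖τ‖ ^ (N + 1))⁻¹

/-- `Γ` is an analytic map `𝕋_h × D → ℂ⁴` that solves `𝒟Γ = X_H(Γ)`, where `H` is defined on `U`,
and has the asymptotic expansion `c` as `τ → ∞` in `D`. Only the values of `Γ` on `strip h ×ˢ D`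
matter. -/
structure IsParameterization (H : Phase → ℂ) (U : Set Phase) (h : ℝ) (D : Set ℂ)
    (c : ℕ → ℂ → Phase) (Γ : ℂ × ℂ → Phase) : Prop where
  analytic : AnalyticOnNhd ℂ Γ (strip h ×ˢ D)
  periodic : ∀ φ ∈ strip h, ∀ τ ∈ D, Γ (φ + 2 * Real.pi, τ) = Γ (φ, τ)
  maps_to : MapsTo Γ (strip h ×ˢ D) U
  solves : ∀ φ ∈ strip h, ∀ τ ∈ D,
    deriv (fun s => Γ (s, τ)) φ + deriv (fun s => Γ (φ, s)) τ = hamVF H (Γ (φ, τ))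
  asymptotics : HasAsymptoticExpansion h D Γ c

end

/-!
The equation `𝒟Γ = X_H(Γ)` is an ordinary differential equation along the characteristics
`t ↦ (φ - t, τ - t)` of `𝒟 = ∂_φ + ∂_τ`, and the domain `𝕋_h × D⁻_r` contains with every point the
half-characteristic `t ≥ 0` that starts there. On it the weight `ρ(τ) = |τ| - Re τ` is comparable
to `|τ|` and grows at least linearly in `t` (`rho_add_le_rho_sub`). Integration from `t = ∞` thus
inverts `𝒟` and maps `O(ρ^{-m-2})` to `O(ρ^{-m-1})` with a norm of order `1/m`
(`weightedLE_charIntVec`).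

Let `Γ_N` be the `N`-th partial sum of the formal series. By the formal equation and the Schwarz
lemma, its residual `𝒟Γ_N - X_H(Γ_N)` is `O(τ^{-N-1})` uniformly on the strip
(`isAsymptoticSolution_of_formalD_eq`). The linear part of `X_H` that comes from `-I₁` generates the
rotations of the two planes, so the substitution `Γ = Γ_N + rot(φ) v` removes it. The rest of `X_H`
gains one power of `ρ` when the coordinates are measured by their orders `2, 2, 1, 1`
(`isRotationPerturbation_hamVF`); this is where the order of `F` enters. Its weighted Lipschitz
constant does not depend on `N`. Hence, for large `N`, the equation for `v` is a fixed point problem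
for a contraction in the unit ball of a weighted space (`exists_weighted_solution`), which gives a
solution with an expansion to order about `N` (`exists_solution_far`); analyticity of the limit
follows from Osgood's lemma. The same smallness shows that the difference of two solutions with the
same expansion to a high order vanishes far away on each characteristic, hence everywhere
(`exists_eqOn_of_hasExpansionUpTo`). Therefore the solutions for different `N` agree, so the
expansion holds to all orders, and the uniqueness also yields the period `2π`.

The sector `D⁺` is reduced to `D⁻` by the substitution `(φ, τ) ↦ (-φ, -τ)`, which changes the sign
of the vector field and replaces `c_k(φ)` by `(-1)^k c_k(-φ)`.
-/

open Metric Filter Topology MeasureTheory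

/-! ### Functions of two complex variables -/

/-- Integration over `[0, 2π]` as a continuous linear functional on `C([0, 2π], ℂ)`. -/
noncomputable def angleIntegral : C(Icc (0 : ℝ) (2 * Real.pi), ℂ) →L[ℂ] ℂ :=
  have : IsFiniteMeasure (Measure.comap ((↑) : Icc (0 : ℝ) (2 * Real.pi) → ℝ) volume) :=
    ⟨by
      rw [comap_subtype_coe_apply measurableSet_Icc, image_univ, Subtype.range_coe]
      exact measure_Icc_lt_top⟩
  LinearMap.mkContinuous
    { toFun := fun g => ∫ t, g t ∂(Measure.comap Subtype.val volume)
      map_add' := fun f g => by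
        have hf := f.continuous.integrable_of_hasCompactSupport
          (μ := Measure.comap Subtype.val volume) (HasCompactSupport.of_compactSpace _)
        have hg := g.continuous.integrable_of_hasCompactSupport
          (μ := Measure.comap Subtype.val volume) (HasCompactSupport.of_compactSpace _)
        simpa using integral_add hf hg
      map_smul' := fun c f => by simpa using integral_const_mul c f }
    ((Measure.comap Subtype.val volume).real (univ : Set (Icc (0 : ℝ) (2 * Real.pi))))
    (fun f => by
      have := norm_integral_le_of_norm_le_const (μ := Measure.comap Subtype.val volume) (f := f)
        (Eventually.of_forall fun t => f.norm_coe_le_norm t)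
      simpa [mul_comm] using this)

theorem angleIntegral_apply (g : C(Icc (0 : ℝ) (2 * Real.pi), ℂ)) :
    angleIntegral g = ∫ t, g t ∂(Measure.comap Subtype.val volume) := rfl

/-- **Osgood's lemma** in two variables: a continuous function that is holomorphic in each variable
separately is analytic. -/
theorem analyticOnNhd_of_separately {f : ℂ × ℂ → ℂ} {U : Set (ℂ × ℂ)} (hU : IsOpen U)
    (hf : ContinuousOn f U)
    (h1 : ∀ x ∈ U, DifferentiableAt ℂ (fun z => f (z, x.2)) x.1)
    (h2 : ∀ x ∈ U, DifferentiableAt ℂ (fun z => f (x.1, z)) x.2) :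
    AnalyticOnNhd ℂ f U := by
  classical
  rintro ⟨a, b⟩ hab
  obtain ⟨r, hr, hrU⟩ : ∃ r > 0, closedBall a r ×ˢ closedBall b r ⊆ U := by
    obtain ⟨r, hr, h⟩ := nhds_basis_closedBall.mem_iff.1 (hU.mem_nhds hab)
    exact ⟨r, hr, by rwa [closedBall_prod_same]⟩
  let K := Icc (0 : ℝ) (2 * Real.pi)
  let circ : C(K, ℂ) := ⟨fun t => circleMap b r t, by fun_prop⟩
  let dcirc : C(K, ℂ) := ⟨fun t => deriv (circleMap b r) t, by
    simp only [deriv_circleMap]; fun_prop⟩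
  have hcirc : ∀ t : K, circ t ∈ sphere b r := fun t => circleMap_mem_sphere _ hr.le _
  -- the slices `ζ ↦ f (ζ, ·)` restricted to the circle around `b`
  let S : ℂ → C(K, ℂ) := fun ζ =>
    if h : ζ ∈ closedBall a r then
      ⟨fun t => f (ζ, circ t), hf.comp_continuous (by fun_prop)
        fun t => hrU ⟨h, sphere_subset_closedBall (hcirc t)⟩⟩ else 0
  have hS : ∀ ζ ∈ closedBall a r, ∀ t, S ζ t = f (ζ, circ t) := fun ζ h t => by
    simp only [S, dif_pos h]; rfl
  have hSc : ContinuousOn S (closedBall a r) := by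
    rw [continuousOn_iff_continuous_domRestrict]
    refine ContinuousMap.continuous_of_continuous_uncurry _ ?_
    have : Continuous fun p : closedBall a r × K => f (p.1, circ p.2) :=
      hf.comp_continuous (by fun_prop)
        fun p => hrU ⟨p.1.2, sphere_subset_closedBall (hcirc p.2)⟩
    refine this.congr fun p => ?_
    simp [Function.uncurry, hS p.1 p.1.2]
  have hSi : CircleIntegrable S a r :=
    (hSc.mono sphere_subset_closedBall).circleIntegrable hr.le
  let G : ℂ → C(K, ℂ) := fun z => (2 * Real.pi * Complex.I : ℂ)⁻¹ • ∮ ζ in C(a, r), (ζ - z)⁻¹ • S ζ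
  have hG : AnalyticAt ℂ G a := by
    have := hasFPowerSeriesOn_cauchy_integral (R := ⟨r, hr.le⟩) hSi hr
    exact this.analyticAt
  have hGf : ∀ z ∈ ball a r, ∀ t, G z t = f (z, circ t) := by
    intro z hz t
    have hd : DifferentiableOn ℂ (fun ζ => f (ζ, circ t)) (closedBall a r) := fun ζ hζ =>
      (h1 (ζ, circ t) (hrU ⟨hζ, sphere_subset_closedBall (hcirc t)⟩)).differentiableWithinAt
    have hc := hd.diffContOnCl_ball subset_rfl |>.two_pi_i_inv_smul_circleIntegral_sub_inv_smul hz
    rw [← hc]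
    have hint : IntervalIntegrable (fun s : ℝ => deriv (circleMap a r) s •
        ((circleMap a r s - z)⁻¹ • S (circleMap a r s))) volume 0 (2 * Real.pi) := by
      apply ContinuousOn.intervalIntegrable
      have hne : ∀ s, circleMap a r s - z ≠ 0 := fun s h => by
        have h1 := circleMap_mem_sphere a hr.le s
        rw [sub_eq_zero.1 h] at h1
        exact absurd (mem_sphere.1 h1) (ne_of_lt (mem_ball.1 hz))
      have hSS : Continuous fun s : ℝ => S (circleMap a r s) :=
        hSc.comp_continuous (by fun_prop) fun s =>
          sphere_subset_closedBall (circleMap_mem_sphere _ hr.le _)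
      simp only [deriv_circleMap]
      have hcm : ∀ c, Continuous fun s : ℝ => circleMap c r s := fun c =>
        continuous_circleMap c r
      have : Continuous fun s : ℝ => (circleMap a r s - z)⁻¹ :=
        Continuous.inv₀ (by fun_prop) hne
      exact (((hcm 0).mul continuous_const).smul (this.smul hSS)).continuousOn
    simp only [G, circleIntegral, ContinuousMap.smul_apply]
    congr 1
    have := (ContinuousMap.evalCLM ℂ t).intervalIntegral_comp_comm hint
    simp only [ContinuousMap.evalCLM_apply] at this
    rw [← this]
    refine intervalIntegral.integral_congr fun s _ => ?_
    simp [hS _ (sphere_subset_closedBall (circleMap_mem_sphere a hr.le s))]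
  -- the Cauchy kernel as a function with values in the Banach algebra `C([0, 2π], ℂ)`
  let k : ℂ → C(K, ℂ) := fun w => Ring.inverse (circ - algebraMap ℂ C(K, ℂ) w)
  have hne : ∀ w ∈ ball b r, ∀ t, circ t - w ≠ 0 := fun w hw t h => by
    have h1 := hcirc t
    rw [sub_eq_zero.1 h] at h1
    exact absurd (mem_sphere.1 h1) (ne_of_lt (mem_ball.1 hw))
  have hunit : ∀ w ∈ ball b r, IsUnit (circ - algebraMap ℂ C(K, ℂ) w) := fun w hw => by
    rw [ContinuousMap.isUnit_iff_forall_ne_zero]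
    intro t; simpa using hne w hw t
  have hk : AnalyticAt ℂ k b := by
    obtain ⟨u, hu⟩ := hunit b (mem_ball_self hr)
    have h1 : AnalyticAt ℂ Ring.inverse (circ - algebraMap ℂ C(K, ℂ) b) := by
      rw [← hu]; exact analyticAt_inverse (𝕜 := ℂ) u
    have h2 : AnalyticAt ℂ (fun w => circ - algebraMap ℂ C(K, ℂ) w) b :=
      analyticAt_const.sub ((Algebra.linearMap ℂ C(K, ℂ)).toContinuousLinearMap.analyticAt b)
    exact AnalyticAt.fun_comp h1 h2
  have hkv : ∀ w ∈ ball b r, ∀ t, k w t = (circ t - w)⁻¹ := fun w hw t => by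
    have := congrArg (fun g : C(K, ℂ) => g t) (Ring.mul_inverse_cancel _ (hunit w hw))
    simp only [ContinuousMap.mul_apply, ContinuousMap.one_apply, ContinuousMap.sub_apply] at this
    exact eq_inv_of_mul_eq_one_right (by simpa [k] using this)
  have hmain : AnalyticAt ℂ (fun x : ℂ × ℂ =>
      (2 * Real.pi * Complex.I : ℂ)⁻¹ • angleIntegral (dcirc * (k x.2 * G x.1))) (a, b) := by
    refine AnalyticAt.fun_const_smul ?_
    refine (angleIntegral.analyticAt _).fun_comp ?_
    refine analyticAt_const.mul (AnalyticAt.mul ?_ ?_)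
    · exact AnalyticAt.fun_comp (f := fun x : ℂ × ℂ => x.2) (x := (a, b)) hk analyticAt_snd
    · exact AnalyticAt.fun_comp (f := fun x : ℂ × ℂ => x.1) (x := (a, b)) hG analyticAt_fst
  refine hmain.congr ?_
  have hnb : ball a r ×ˢ ball b r ∈ 𝓝 (a, b) :=
    prod_mem_nhds (ball_mem_nhds _ hr) (ball_mem_nhds _ hr)
  filter_upwards [hnb] with ⟨z, w⟩ ⟨hz, hw⟩
  have hd : DifferentiableOn ℂ (fun ζ => f (z, ζ)) (closedBall b r) := fun ζ hζ =>
    (h2 (z, ζ) (hrU ⟨ball_subset_closedBall hz, hζ⟩)).differentiableWithinAt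
  have hc := hd.diffContOnCl_ball subset_rfl |>.two_pi_i_inv_smul_circleIntegral_sub_inv_smul hw
  rw [← hc]
  congr 1
  simp only [circleIntegral]
  rw [intervalIntegral.integral_of_le (by positivity), ← integral_Icc_eq_integral_Ioc,
    ← integral_subtype_comap measurableSet_Icc]
  rw [angleIntegral_apply]
  refine integral_congr_ae (Eventually.of_forall fun t => ?_)
  simp [hkv w hw t, hGf z hz t, dcirc, circ]

/-! ### The weight and the regions invariant under translation to the left -/

/-- The weight `ρ(τ) = |τ| - Re τ`. It is comparable to `|τ|` away from the positive real axis, and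
it grows at least linearly when `τ` moves to the left. -/
noncomputable def rho (τ : ℂ) : ℝ := ‖τ‖ - τ.re

/-- The part `ρ > R` of the sector `κ|τ| < ρ(τ)`, which for `κ = 1 - cos θ` is `|arg τ| > θ`. -/
def leftRegion (κ R : ℝ) : Set ℂ := {τ | κ * ‖τ‖ < rho τ ∧ R < rho τ}

theorem continuous_rho : Continuous rho := by unfold rho; fun_prop

theorem isOpen_leftRegion (κ R : ℝ) : IsOpen (leftRegion κ R) := by
  have := continuous_rho
  exact (isOpen_lt (by fun_prop) this).inter (isOpen_lt continuous_const this)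

theorem isOpen_strip (h : ℝ) : IsOpen (strip h) :=
  isOpen_lt (by fun_prop) continuous_const

theorem rho_le_two_mul (τ : ℂ) : rho τ ≤ 2 * ‖τ‖ := by
  have := Complex.abs_re_le_norm τ
  have := neg_abs_le τ.re
  unfold rho; linarith

theorem rho_add_le_rho_sub {κ : ℝ} (hκ : κ ≤ 1) {τ : ℂ} (hτ : κ * ‖τ‖ ≤ rho τ) {t : ℝ}
    (ht : 0 ≤ t) : rho τ + κ * t ≤ rho (τ - t) := by
  have key : ‖τ‖ - t * (1 - κ) ≤ ‖τ - t‖ := by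
    rcases eq_or_ne τ 0 with rfl | h0
    · simp; nlinarith [abs_nonneg t]
    have hpos : 0 < ‖τ‖ := norm_pos_iff.2 h0
    have h1 : ((τ - t) * (starRingEnd ℂ) τ).re ≤ ‖τ - t‖ * ‖τ‖ := by
      refine (Complex.re_le_norm _).trans ?_
      rw [norm_mul, RCLike.norm_conj]
    have h2 : ((τ - t) * (starRingEnd ℂ) τ).re = ‖τ‖ ^ 2 - t * τ.re := by
      rw [← Complex.normSq_eq_norm_sq, Complex.normSq_apply]
      simp; ring
    have h3 : τ.re ≤ (1 - κ) * ‖τ‖ := by unfold rho at hτ; linarith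
    rw [h2] at h1
    have : (‖τ‖ - t * (1 - κ)) * ‖τ‖ ≤ ‖τ - t‖ * ‖τ‖ := by nlinarith
    exact le_of_mul_le_mul_right this hpos
  have : (τ - t).re = τ.re - t := by simp
  unfold rho at *
  rw [this]; linarith

theorem norm_lt_rho_sub {κ : ℝ} (hκ : κ ≤ 1) (hκ0 : 0 ≤ κ) {τ : ℂ} (hτ : κ * ‖τ‖ < rho τ) {t : ℝ}
    (ht : 0 ≤ t) : κ * ‖τ - t‖ < rho (τ - t) := by
  have h1 : ‖τ‖ ≤ ‖τ - t‖ + t := by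
    have := norm_add_le (τ - t) (t : ℂ)
    simpa [abs_of_nonneg ht] using this
  have : (τ - t).re = τ.re - t := by simp
  unfold rho at *
  rw [this]; nlinarith

theorem sub_mem_leftRegion {κ R : ℝ} (hκ : κ ≤ 1) (hκ0 : 0 ≤ κ) {τ : ℂ} (hτ : τ ∈ leftRegion κ R)
    {t : ℝ} (ht : 0 ≤ t) : τ - t ∈ leftRegion κ R := by
  refine ⟨norm_lt_rho_sub hκ hκ0 hτ.1 ht, hτ.2.trans_le ?_⟩
  have := rho_add_le_rho_sub hκ hτ.1.le ht
  nlinarith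

theorem sub_mem_strip {h : ℝ} {φ : ℂ} (hφ : φ ∈ strip h) (t : ℝ) : φ - t ∈ strip h := by
  simpa [strip] using hφ

/-! ### Integration along the characteristics of `∂_φ + ∂_τ` -/

theorem hasDerivAt_neg_inv_pow {A κ : ℝ} (hA : 0 < A) (hκ : 0 < κ) (m : ℕ) {t : ℝ} (ht : 0 ≤ t) :
    HasDerivAt (fun t => -(((κ * (m + 1)) * (A + κ * t) ^ (m + 1))⁻¹))
      (((A + κ * t) ^ (m + 2))⁻¹) t := by
  have hp : 0 < A + κ * t := by positivity
  have h1 : HasDerivAt (fun t => A + κ * t) κ t := by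
    simpa using ((hasDerivAt_id t).const_mul κ).const_add A
  have h2 := (((h1.fun_pow (m + 1)).const_mul (κ * (m + 1))).fun_inv (by positivity)).neg
  refine h2.congr_deriv ?_
  have : (m + 1 : ℝ) ≠ 0 := by positivity
  push_cast
  field_simp
  ring_nf

theorem tendsto_neg_inv_pow {A κ : ℝ} (hκ : 0 < κ) (m : ℕ) :
    Tendsto (fun t => -(((κ * (m + 1)) * (A + κ * t) ^ (m + 1))⁻¹)) atTop (𝓝 0) := by
  rw [← neg_zero]
  refine (tendsto_inv_atTop_zero.comp ?_).neg
  refine Tendsto.const_mul_atTop (by positivity) ?_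
  refine (tendsto_pow_atTop (by omega)).comp ?_
  exact tendsto_atTop_add_const_left _ _ (tendsto_id.const_mul_atTop hκ)

theorem integrableOn_inv_pow {A κ : ℝ} (hA : 0 < A) (hκ : 0 < κ) (m : ℕ) :
    IntegrableOn (fun t => ((A + κ * t) ^ (m + 2))⁻¹) (Ioi 0) := by
  refine integrableOn_Ioi_deriv_of_nonneg' (fun t ht => hasDerivAt_neg_inv_pow hA hκ m ht)
    (fun t ht => ?_) (tendsto_neg_inv_pow hκ m)
  have : 0 < t := ht
  positivity

theorem integral_inv_pow {A κ : ℝ} (hA : 0 < A) (hκ : 0 < κ) (m : ℕ) :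
    ∫ t in Ioi 0, ((A + κ * t) ^ (m + 2))⁻¹ = (κ * (m + 1))⁻¹ * (A ^ (m + 1))⁻¹ := by
  rw [integral_Ioi_of_hasDerivAt_of_nonneg' (fun t ht => hasDerivAt_neg_inv_pow hA hκ m ht)
    (fun t ht => ?_) (tendsto_neg_inv_pow hκ m)]
  · simp [mul_comm]
  · have : 0 < t := ht
    positivity

/-- The point `(t, t)` of the characteristic direction of `∂_φ + ∂_τ`. -/
def diagPt (t : ℝ) : ℂ × ℂ := (t, t)

/-- The integral of `k` over the characteristic half-line that arrives at `x` from `τ = -∞`. -/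
noncomputable def charInt (k : ℂ × ℂ → ℂ) (x : ℂ × ℂ) : ℂ := ∫ t in Ioi (0 : ℝ), k (x - diagPt t)

theorem continuous_diagPt : Continuous diagPt := by unfold diagPt; fun_prop

/-- The domain of the solutions: a strip in `φ` times a left region in `τ`. -/
def domain (h κ R : ℝ) : Set (ℂ × ℂ) := strip h ×ˢ leftRegion κ R

theorem isOpen_domain (h κ R : ℝ) : IsOpen (domain h κ R) :=
  (isOpen_strip h).prod (isOpen_leftRegion κ R)

theorem sub_diag_mem_domain {h κ R : ℝ} (hκ : κ ≤ 1) (hκ0 : 0 ≤ κ) {x : ℂ × ℂ}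
    (hx : x ∈ domain h κ R) {t : ℝ} (ht : 0 ≤ t) : x - diagPt t ∈ domain h κ R :=
  ⟨sub_mem_strip hx.1 t, sub_mem_leftRegion hκ hκ0 hx.2 ht⟩

section charInt

variable {h κ R a : ℝ} {m : ℕ} {k : ℂ × ℂ → ℂ}

theorem norm_comp_sub_diag_le (hκ : κ ≤ 1) (hκ0 : 0 < κ) (ha : 0 ≤ a)
    (hb : ∀ x ∈ domain h κ R, ‖k x‖ ≤ a * (rho x.2 ^ m)⁻¹) {x : ℂ × ℂ}
    (hx : x ∈ domain h κ R) {t : ℝ} (ht : 0 ≤ t) {A : ℝ} (hA : 0 < A) (hAx : A ≤ rho x.2) :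
    ‖k (x - diagPt t)‖ ≤ a * ((A + κ * t) ^ m)⁻¹ := by
  refine (hb _ (sub_diag_mem_domain hκ hκ0.le hx ht)).trans ?_
  have h1 := rho_add_le_rho_sub hκ hx.2.1.le ht
  have h2 : 0 < A + κ * t := by positivity
  have h3 : (x - diagPt t).2 = x.2 - t := rfl
  rw [h3]
  gcongr
  linarith

theorem integrableOn_comp_sub_diag (hκ : κ ≤ 1) (hκ0 : 0 < κ) (hR : 0 ≤ R) (ha : 0 ≤ a)
    (hk : ContinuousOn k (domain h κ R))
    (hb : ∀ x ∈ domain h κ R, ‖k x‖ ≤ a * (rho x.2 ^ (m + 2))⁻¹) {x : ℂ × ℂ}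
    (hx : x ∈ domain h κ R) : IntegrableOn (fun t : ℝ => k (x - diagPt t)) (Ioi 0) := by
  have hA : 0 < rho x.2 := hR.trans_lt hx.2.2
  refine Integrable.mono' ((integrableOn_inv_pow hA hκ0 m).const_mul a) ?_ ?_
  · refine ContinuousOn.aestronglyMeasurable ?_ measurableSet_Ioi
    refine hk.comp (continuous_const.sub continuous_diagPt).continuousOn fun t ht => ?_
    exact sub_diag_mem_domain hκ hκ0.le hx (le_of_lt ht)
  · refine (ae_restrict_iff' measurableSet_Ioi).2 (Eventually.of_forall fun t ht => ?_)
    exact norm_comp_sub_diag_le hκ hκ0 ha hb hx (le_of_lt ht) hA le_rfl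

/-- Integration along characteristics gains one power of the weight, with the small constant
`1 / (κ (m + 1))`. -/
theorem norm_charInt_le (hκ : κ ≤ 1) (hκ0 : 0 < κ) (hR : 0 ≤ R) (ha : 0 ≤ a)
    (hb : ∀ x ∈ domain h κ R, ‖k x‖ ≤ a * (rho x.2 ^ (m + 2))⁻¹) {x : ℂ × ℂ}
    (hx : x ∈ domain h κ R) :
    ‖charInt k x‖ ≤ a / (κ * (m + 1)) * (rho x.2 ^ (m + 1))⁻¹ := by
  have hA : 0 < rho x.2 := hR.trans_lt hx.2.2
  have := norm_integral_le_of_norm_le (f := fun t : ℝ => k (x - diagPt t))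
    ((integrableOn_inv_pow hA hκ0 m).const_mul a)
    ((ae_restrict_iff' measurableSet_Ioi).2 (Eventually.of_forall fun t ht =>
      norm_comp_sub_diag_le hκ hκ0 ha hb hx (le_of_lt ht) hA le_rfl))
  refine this.trans_eq ?_
  rw [integral_const_mul, integral_inv_pow hA hκ0 m]
  ring

theorem hasFDerivAt_charInt (hκ : κ ≤ 1) (hκ0 : 0 < κ) (hR : 0 ≤ R) (ha : 0 ≤ a)
    (hk : DifferentiableOn ℂ k (domain h κ R))
    (hb : ∀ x ∈ domain h κ R, ‖k x‖ ≤ a * (rho x.2 ^ (m + 2))⁻¹) {x : ℂ × ℂ}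
    (hx : x ∈ domain h κ R) :
    IntegrableOn (fun t : ℝ => fderiv ℂ k (x - diagPt t)) (Ioi 0) ∧
    HasFDerivAt (charInt k) (∫ t in Ioi (0 : ℝ), fderiv ℂ k (x - diagPt t)) x := by
  have hΩ := isOpen_domain h κ R
  have hA : 0 < rho x.2 := hR.trans_lt hx.2.2
  have hcr : Continuous fun y : ℂ × ℂ => rho y.2 := continuous_rho.comp continuous_snd
  obtain ⟨ε, hε, hball⟩ : ∃ ε > 0, ∀ y ∈ ball x (2 * ε),
      y ∈ domain h κ R ∧ rho x.2 / 2 ≤ rho y.2 := by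
    have h1 : ∀ᶠ y in 𝓝 x, y ∈ domain h κ R ∧ rho x.2 / 2 ≤ rho y.2 :=
      Filter.Eventually.and (hΩ.mem_nhds hx)
        (hcr.continuousAt.eventually (lt_mem_nhds (half_lt_self hA)) |>.mono
          fun y hy => le_of_lt hy)
    obtain ⟨ε, hε, hb⟩ := Metric.eventually_nhds_iff_ball.1 h1
    exact ⟨ε / 2, by positivity, fun y hy => hb y (by convert hy using 2; ring)⟩
  have hA2 : 0 < rho x.2 / 2 := by positivity
  -- the Cauchy estimate for the derivative of the integrand, on a ball carried along the line
  have hbound : ∀ t : ℝ, 0 < t → ∀ y ∈ ball x ε,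
      ‖fderiv ℂ k (y - diagPt t)‖ ≤ 2 * a / ε * ((rho x.2 / 2 + κ * t) ^ (m + 2))⁻¹ := by
    intro t ht y hy
    have hsub : ∀ z ∈ ball (y - diagPt t) ε, z + diagPt t ∈ ball x (2 * ε) := by
      intro z hz
      rw [mem_ball, dist_eq_norm] at *
      calc ‖z + diagPt t - x‖ = ‖(z - (y - diagPt t)) + (y - x)‖ := by congr 1; abel
        _ ≤ ‖z - (y - diagPt t)‖ + ‖y - x‖ := norm_add_le _ _
        _ < 2 * ε := by linarith
    have hz : ∀ z ∈ ball (y - diagPt t) ε, z ∈ domain h κ R ∧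
        ‖k z‖ ≤ a * ((rho x.2 / 2 + κ * t) ^ (m + 2))⁻¹ := by
      intro z hz
      have h1 := hball _ (hsub z hz)
      have h2 : z = (z + diagPt t) - diagPt t := by abel
      rw [h2]
      exact ⟨sub_diag_mem_domain hκ hκ0.le h1.1 ht.le,
        norm_comp_sub_diag_le hκ hκ0 ha hb h1.1 ht.le hA2 h1.2⟩
    refine (Complex.norm_fderiv_le_div_of_mapsTo_ball
      (R₂ := 2 * (a * ((rho x.2 / 2 + κ * t) ^ (m + 2))⁻¹)) (R₁ := ε)
      (hk.mono fun z h => (hz z h).1) (fun z h => ?_) hε).trans_eq (by ring)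
    rw [mem_closedBall, dist_eq_norm, two_mul]
    exact (norm_sub_le _ _).trans
      (add_le_add (hz z h).2 (hz _ (mem_ball_self hε)).2)
  have hint : IntegrableOn (fun t => 2 * a / ε * ((rho x.2 / 2 + κ * t) ^ (m + 2))⁻¹) (Ioi 0) :=
    (integrableOn_inv_pow hA2 hκ0 m).const_mul _
  have hmeas : AEStronglyMeasurable (fun t : ℝ => fderiv ℂ k (x - diagPt t))
      (volume.restrict (Ioi 0)) := by
    refine Measurable.aestronglyMeasurable ?_
    have hc : Continuous fun t : ℝ => x - diagPt t := continuous_const.sub continuous_diagPt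
    exact (measurable_fderiv ℂ k).comp hc.measurable
  have hd : ∀ t : ℝ, 0 < t → ∀ y ∈ ball x ε,
      HasFDerivAt (fun y => k (y - diagPt t)) (fderiv ℂ k (y - diagPt t)) y := by
    intro t ht y hy
    have hy' := (hball y (ball_subset_ball (by linarith) hy)).1
    have := (hk.differentiableAt (hΩ.mem_nhds
      (sub_diag_mem_domain hκ hκ0.le hy' ht.le))).hasFDerivAt
    exact (hasFDerivAt_comp_sub (diagPt t)).2 this
  refine ⟨Integrable.mono' hint hmeas ((ae_restrict_iff' measurableSet_Ioi).2
    (Eventually.of_forall fun t ht => hbound t ht x (mem_ball_self hε))), ?_⟩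
  refine hasFDerivAt_integral_of_dominated_of_fderiv_le (μ := volume.restrict (Ioi 0))
    (F := fun y (t : ℝ) => k (y - diagPt t)) (F' := fun y t => fderiv ℂ k (y - diagPt t))
    (ball_mem_nhds x hε) ?_
    (integrableOn_comp_sub_diag hκ hκ0 hR ha hk.continuousOn hb hx) hmeas
    ((ae_restrict_iff' measurableSet_Ioi).2 (Eventually.of_forall fun t ht => hbound t ht))
    hint ((ae_restrict_iff' measurableSet_Ioi).2 (Eventually.of_forall fun t ht => hd t ht))
  filter_upwards [hΩ.mem_nhds hx] with y hy
  exact (integrableOn_comp_sub_diag hκ hκ0 hR ha hk.continuousOn hb hy).aestronglyMeasurable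

/-- `charInt k` solves `(∂_φ + ∂_τ) v = k`. -/
theorem fderiv_charInt_apply (hκ : κ ≤ 1) (hκ0 : 0 < κ) (hR : 0 ≤ R) (ha : 0 ≤ a)
    (hk : DifferentiableOn ℂ k (domain h κ R))
    (hb : ∀ x ∈ domain h κ R, ‖k x‖ ≤ a * (rho x.2 ^ (m + 2))⁻¹) {x : ℂ × ℂ}
    (hx : x ∈ domain h κ R) : fderiv ℂ (charInt k) x (1, 1) = k x := by
  obtain ⟨hi, hd⟩ := hasFDerivAt_charInt hκ hκ0 hR ha hk hb hx
  have hA : 0 < rho x.2 := hR.trans_lt hx.2.2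
  have hder : ∀ t ∈ Ici (0 : ℝ), HasDerivAt (fun t : ℝ => k (x - diagPt t))
      (-(fderiv ℂ k (x - diagPt t) (1, 1))) t := by
    intro t ht
    have h1 := (hk.differentiableAt ((isOpen_domain h κ R).mem_nhds
      (sub_diag_mem_domain hκ hκ0.le hx ht))).hasFDerivAt
    have h2 : HasDerivAt (fun t : ℝ => x - diagPt t) (-(1, 1)) t := by
      refine HasDerivAt.const_sub x ?_
      exact (Complex.ofRealCLM.hasDerivAt (x := t)).prodMk (Complex.ofRealCLM.hasDerivAt (x := t))
    have := (h1.restrictScalars ℝ).comp_hasDerivAt t h2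
    rw [map_neg] at this
    exact this
  have hlim : Tendsto (fun t : ℝ => k (x - diagPt t)) atTop (𝓝 0) := by
    refine squeeze_zero_norm' (a := fun t => a * ((rho x.2 + κ * t) ^ (m + 2))⁻¹) ?_ ?_
    · filter_upwards [eventually_ge_atTop 0] with t ht
      exact norm_comp_sub_diag_le hκ hκ0 ha hb hx ht hA le_rfl
    · rw [← mul_zero a]
      refine (tendsto_inv_atTop_zero.comp ((tendsto_pow_atTop (by omega)).comp ?_)).const_mul a
      exact tendsto_atTop_add_const_left _ _ (tendsto_id.const_mul_atTop hκ0)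
  have := integral_Ioi_of_hasDerivAt_of_tendsto' hder
    (((ContinuousLinearMap.apply ℂ ℂ ((1 : ℂ), (1 : ℂ))).integrable_comp hi).neg) hlim
  rw [hd.fderiv]
  have h3 := ((ContinuousLinearMap.apply ℂ ℂ ((1 : ℂ), (1 : ℂ))).integral_comp_comm hi)
  simp only [ContinuousLinearMap.apply_apply] at h3
  rw [← h3]
  rw [integral_neg] at this
  have h0 : diagPt 0 = 0 := by simp [diagPt]
  rw [h0] at this
  simpa using this

end charInt

/-! ### A weighted contraction principle -/

/-- The bound `|vᵢ| ≤ a ρ^{-(M + wᵢ)}`, where `wᵢ` is the weight of the `i`-th coordinate. -/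
def WeightedLE (M : ℕ) (ρ a : ℝ) (v : Phase) : Prop :=
  ∀ i, ‖v i‖ ≤ a * (ρ ^ (M + coordWeight i))⁻¹

theorem coordWeight_pos (i : Fin 4) : 1 ≤ coordWeight i := by
  fin_cases i <;> simp [coordWeight]

namespace WeightedLE

variable {M : ℕ} {ρ a b : ℝ} {v w : Phase}

theorem add (hv : WeightedLE M ρ a v) (hw : WeightedLE M ρ b w) :
    WeightedLE M ρ (a + b) (v + w) := fun i => by
  rw [add_mul]
  exact (norm_add_le _ _).trans (add_le_add (hv i) (hw i))

theorem mono (hv : WeightedLE M ρ a v) (hρ : 0 ≤ ρ) (hab : a ≤ b) : WeightedLE M ρ b v :=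
  fun i => (hv i).trans (by gcongr)

theorem zero (hρ : 0 ≤ ρ) (ha : 0 ≤ a) : WeightedLE M ρ a 0 := fun i => by
  simp only [Pi.zero_apply, norm_zero]; positivity

theorem neg (hv : WeightedLE M ρ a v) : WeightedLE M ρ a (-v) := fun i => by
  simpa using hv i

theorem sub (hv : WeightedLE M ρ a v) (hw : WeightedLE M ρ b w) :
    WeightedLE M ρ (a + b) (v - w) := by
  rw [sub_eq_add_neg]; exact hv.add hw.neg

end WeightedLE

/-- Integration along characteristics, coordinate by coordinate. -/
noncomputable def charIntVec (k : ℂ × ℂ → Phase) (x : ℂ × ℂ) : Phase :=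
  fun i => charInt (fun y => k y i) x

section charIntVec

variable {h κ R a : ℝ} {M : ℕ} {k : ℂ × ℂ → Phase}

theorem weightedLE_succ_iff {ρ : ℝ} {v : Phase} : WeightedLE (M + 1) ρ a v ↔
    ∀ i, ‖v i‖ ≤ a * (ρ ^ (M + coordWeight i - 1 + 2))⁻¹ := by
  refine forall_congr' fun i => ?_
  have := coordWeight_pos i
  rw [show M + coordWeight i - 1 + 2 = M + 1 + coordWeight i by omega]

theorem weightedLE_charIntVec (hκ : κ ≤ 1) (hκ0 : 0 < κ) (hR : 0 ≤ R) (ha : 0 ≤ a)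
    (hb : ∀ x ∈ domain h κ R, WeightedLE (M + 1) (rho x.2) a (k x)) {x : ℂ × ℂ}
    (hx : x ∈ domain h κ R) :
    WeightedLE M (rho x.2) (a / (κ * (M + 1))) (charIntVec k x) := by
  intro i
  have hρ : 0 < rho x.2 := hR.trans_lt hx.2.2
  have h1 := norm_charInt_le hκ hκ0 hR ha (fun y hy => weightedLE_succ_iff.1 (hb y hy) i) hx
  have hw := coordWeight_pos i
  rw [show M + coordWeight i - 1 + 1 = M + coordWeight i by omega] at h1
  refine h1.trans ?_
  have : (M : ℝ) ≤ ((M + coordWeight i - 1 : ℕ) : ℝ) := by exact_mod_cast by omega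
  gcongr

theorem differentiableOn_charIntVec (hκ : κ ≤ 1) (hκ0 : 0 < κ) (hR : 0 ≤ R) (ha : 0 ≤ a)
    (hk : DifferentiableOn ℂ k (domain h κ R))
    (hb : ∀ x ∈ domain h κ R, WeightedLE (M + 1) (rho x.2) a (k x)) :
    DifferentiableOn ℂ (charIntVec k) (domain h κ R) := by
  rw [differentiableOn_pi]
  intro i x hx
  exact (hasFDerivAt_charInt hκ hκ0 hR ha (differentiableOn_pi.1 hk i)
    (fun y hy => weightedLE_succ_iff.1 (hb y hy) i) hx).2.differentiableAt.differentiableWithinAt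

theorem charIntVec_sub {k' : ℂ × ℂ → Phase} {a' : ℝ} (hκ : κ ≤ 1) (hκ0 : 0 < κ) (hR : 0 ≤ R)
    (ha : 0 ≤ a) (ha' : 0 ≤ a') (hk : ContinuousOn k (domain h κ R))
    (hk' : ContinuousOn k' (domain h κ R))
    (hb : ∀ x ∈ domain h κ R, WeightedLE (M + 1) (rho x.2) a (k x))
    (hb' : ∀ x ∈ domain h κ R, WeightedLE (M + 1) (rho x.2) a' (k' x)) {x : ℂ × ℂ}
    (hx : x ∈ domain h κ R) :
    charIntVec k x - charIntVec k' x = charIntVec (k - k') x := by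
  ext i
  refine (integral_sub ?_ ?_).symm
  · exact integrableOn_comp_sub_diag hκ hκ0 hR ha (continuousOn_pi.1 hk i)
      (fun y hy => weightedLE_succ_iff.1 (hb y hy) i) hx
  · exact integrableOn_comp_sub_diag hκ hκ0 hR ha' (continuousOn_pi.1 hk' i)
      (fun y hy => weightedLE_succ_iff.1 (hb' y hy) i) hx

end charIntVec

/-- A uniform limit of holomorphic maps of two variables is analytic. -/
theorem analyticOnNhd_of_tendstoUniformlyOn {v : ℕ → ℂ × ℂ → Phase} {w : ℂ × ℂ → Phase}
    {U : Set (ℂ × ℂ)} (hU : IsOpen U) (hv : ∀ n, DifferentiableOn ℂ (v n) U)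
    (hlim : TendstoUniformlyOn v w atTop U) : AnalyticOnNhd ℂ w U := by
  have hlim' : ∀ i, TendstoUniformlyOn (fun n x => v n x i) (fun x => w x i) atTop U := fun i =>
    (Pi.uniformContinuous_proj _ i).comp_tendstoUniformlyOn hlim
  have hvi := fun n => differentiableOn_pi.1 (hv n)
  intro x hx
  rw [analyticAt_pi_iff]
  intro i
  refine analyticOnNhd_of_separately hU ?_ ?_ ?_ x hx
  · exact (hlim' i).continuousOn (Frequently.of_forall fun n => (hvi n i).continuousOn)
  · rintro ⟨a, b⟩ hab
    have hc : Continuous fun z : ℂ => (z, b) := by fun_prop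
    have hT := ((hlim' i).comp fun z : ℂ => (z, b)).tendstoLocallyUniformlyOn
    refine (hT.differentiableOn (Eventually.of_forall fun n => ?_)
      (hU.preimage hc)).differentiableAt ((hU.preimage hc).mem_nhds hab)
    exact (hvi n i).comp (by fun_prop) fun z hz => hz
  · rintro ⟨a, b⟩ hab
    have hc : Continuous fun z : ℂ => (a, z) := by fun_prop
    have hT := ((hlim' i).comp fun z : ℂ => (a, z)).tendstoLocallyUniformlyOn
    refine (hT.differentiableOn (Eventually.of_forall fun n => ?_)
      (hU.preimage hc)).differentiableAt ((hU.preimage hc).mem_nhds hab)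
    exact (hvi n i).comp (by fun_prop) fun z hz => hz

/-- Solvability of `(∂_φ + ∂_τ) v = Ψ(x, v)` in the unit ball of the weighted norm: integration
along characteristics turns the equation into a fixed point problem for a map that contracts by
`1/2`, as soon as the Lipschitz constant `L` of `Ψ` is small compared with the exponent `M`. -/
theorem exists_weighted_solution {h κ R L : ℝ} {M : ℕ} (hκ : κ ≤ 1) (hκ0 : 0 < κ) (hR : 1 ≤ R)
    (hL0 : 0 ≤ L) (hL : L ≤ κ * (M + 1) / 2) (Ψ : ℂ × ℂ → Phase → Phase)
    (hdiff : ∀ v : ℂ × ℂ → Phase, DifferentiableOn ℂ v (domain h κ R) →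
      (∀ x ∈ domain h κ R, WeightedLE M (rho x.2) 1 (v x)) →
      DifferentiableOn ℂ (fun x => Ψ x (v x)) (domain h κ R))
    (hlip : ∀ x ∈ domain h κ R, ∀ v v', WeightedLE M (rho x.2) 1 v → WeightedLE M (rho x.2) 1 v' →
      ∀ a ≥ 0, WeightedLE M (rho x.2) a (v - v') →
        WeightedLE (M + 1) (rho x.2) (L * a) (Ψ x v - Ψ x v'))
    (hzero : ∀ x ∈ domain h κ R, WeightedLE (M + 1) (rho x.2) L (Ψ x 0)) :
    ∃ v : ℂ × ℂ → Phase, AnalyticOnNhd ℂ v (domain h κ R) ∧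
      (∀ x ∈ domain h κ R, WeightedLE M (rho x.2) 1 (v x)) ∧
      ∀ x ∈ domain h κ R, fderiv ℂ v x (1, 1) = Ψ x (v x) := by
  set Ω := domain h κ R
  have hΩ : IsOpen Ω := isOpen_domain h κ R
  have hR0 : 0 ≤ R := by linarith
  have hρ : ∀ x ∈ Ω, 1 ≤ rho x.2 := fun x hx => hR.trans hx.2.2.le
  have hρ0 : ∀ x ∈ Ω, 0 ≤ rho x.2 := fun x hx => zero_le_one.trans (hρ x hx)
  let T : (ℂ × ℂ → Phase) → ℂ × ℂ → Phase := fun v => charIntVec fun x => Ψ x (v x)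
  let Adm : (ℂ × ℂ → Phase) → Prop := fun v =>
    DifferentiableOn ℂ v Ω ∧ ∀ x ∈ Ω, WeightedLE M (rho x.2) 1 (v x)
  have hhalf : ∀ b, 0 ≤ b → L * b / (κ * (M + 1)) ≤ b / 2 := fun b hb => by
    rw [div_le_iff₀ (by positivity)]
    nlinarith
  have hbd : ∀ v, Adm v → ∀ x ∈ Ω, WeightedLE (M + 1) (rho x.2) (L * 1 + L) (Ψ x (v x)) := by
    intro v hv x hx
    have := (hlip x hx (v x) 0 (hv.2 x hx) (WeightedLE.zero (hρ0 x hx) zero_le_one) 1 zero_le_one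
      (by simpa using hv.2 x hx)).add (hzero x hx)
    simpa using this
  have hTdiff : ∀ v, Adm v → DifferentiableOn ℂ (T v) Ω := fun v hv =>
    differentiableOn_charIntVec hκ hκ0 hR0 (by positivity) (hdiff v hv.1 hv.2) (hbd v hv)
  have hTlip : ∀ v v', Adm v → Adm v' → ∀ b ≥ 0, (∀ x ∈ Ω, WeightedLE M (rho x.2) b (v x - v' x)) →
      ∀ x ∈ Ω, WeightedLE M (rho x.2) (b / 2) (T v x - T v' x) := by
    intro v v' hv hv' b hb hvv x hx
    rw [charIntVec_sub hκ hκ0 hR0 (by positivity) (by positivity) (hdiff v hv.1 hv.2).continuousOn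
      (hdiff v' hv'.1 hv'.2).continuousOn (hbd v hv) (hbd v' hv') hx]
    refine (weightedLE_charIntVec hκ hκ0 hR0 (a := L * b) (by positivity) (fun y hy => ?_)
      hx).mono (hρ0 x hx) (hhalf b hb)
    exact hlip y hy _ _ (hv.2 y hy) (hv'.2 y hy) b hb (hvv y hy)
  let v : ℕ → ℂ × ℂ → Phase := fun n => T^[n] 0
  have hvs : ∀ n, v (n + 1) = T (v n) := fun n => Function.iterate_succ_apply' T n 0
  have hmain : ∀ n, Adm (v n) ∧ (∀ x ∈ Ω, WeightedLE M (rho x.2) (1 - (1 / 2) ^ n) (v n x)) ∧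
      ∀ x ∈ Ω, WeightedLE M (rho x.2) ((1 / 2) ^ (n + 1)) (v n x - v (n + 1) x) := by
    intro n
    induction n with
    | zero =>
      have hA : Adm (v 0) := ⟨differentiableOn_const 0, fun x hx =>
        WeightedLE.zero (hρ0 x hx) zero_le_one⟩
      refine ⟨hA, fun x hx => WeightedLE.zero (hρ0 x hx) (by simp), fun x hx => ?_⟩
      have h1 := (weightedLE_charIntVec (M := M) hκ hκ0 hR0 hL0 hzero hx).mono (hρ0 x hx)
        (by simpa using hhalf 1 zero_le_one)
      have h2 : v 0 x - v 1 x = -(charIntVec (fun x => Ψ x 0) x) := by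
        rw [hvs]; exact zero_sub _
      rw [h2]
      simpa using h1.neg
    | succ n ih =>
      obtain ⟨hA, hb, hd⟩ := ih
      have hb' : ∀ x ∈ Ω, WeightedLE M (rho x.2) (1 - (1 / 2) ^ (n + 1)) (v (n + 1) x) := by
        intro x hx
        have := (hb x hx).sub (hd x hx)
        rw [sub_sub_cancel] at this
        exact this.mono (hρ0 x hx) (by rw [pow_succ]; linarith)
      have hA' : Adm (v (n + 1)) := by
        refine ⟨by rw [hvs]; exact hTdiff _ hA, fun x hx => (hb' x hx).mono (hρ0 x hx) ?_⟩
        have : (0 : ℝ) ≤ (1 / 2) ^ (n + 1) := by positivity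
        linarith
      refine ⟨hA', hb', fun x hx => ?_⟩
      have := hTlip _ _ hA hA' _ (by positivity) hd x hx
      rw [← hvs, ← hvs] at this
      exact this.mono (hρ0 x hx) (by rw [pow_succ _ (n + 1)]; linarith)
  -- the iterates converge, uniformly and at a geometric rate
  have hlim : ∀ x, ∃ w : Phase, x ∈ Ω → ∀ i, Tendsto (fun n => v n x i) atTop (𝓝 (w i)) := by
    intro x
    by_cases hx : x ∈ Ω
    · have : ∀ i, ∃ z, Tendsto (fun n => v n x i) atTop (𝓝 z) := fun i => by
        refine cauchySeq_tendsto_of_complete (cauchySeq_of_le_geometric (1 / 2)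
          (1 / 2 * (rho x.2 ^ (M + coordWeight i))⁻¹) (by norm_num) fun n => ?_)
        rw [dist_eq_norm]
        exact ((hmain n).2.2 x hx i).trans_eq (by ring)
      choose w hw using this
      exact ⟨w, fun _ => hw⟩
    · exact ⟨0, fun h => absurd h hx⟩
  choose w hw using hlim
  have hclose : ∀ n, ∀ x ∈ Ω, WeightedLE M (rho x.2) ((1 / 2) ^ n) (v n x - w x) := by
    intro n x hx i
    have := dist_le_of_le_geometric_of_tendsto (1 / 2)
      (1 / 2 * (rho x.2 ^ (M + coordWeight i))⁻¹) (by norm_num) (fun n => by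
        rw [dist_eq_norm]
        exact ((hmain n).2.2 x hx i).trans_eq (by ring)) (hw x hx i) n
    rw [dist_eq_norm] at this
    exact this.trans_eq (by ring)
  have hunif : TendstoUniformlyOn v w atTop Ω := by
    rw [Metric.tendstoUniformlyOn_iff]
    intro ε hε
    have h0 : Tendsto (fun n : ℕ => (1 / 2 : ℝ) ^ n) atTop (𝓝 0) :=
      tendsto_pow_atTop_nhds_zero_of_lt_one (by norm_num) (by norm_num)
    filter_upwards [h0.eventually (gt_mem_nhds hε)] with n hn x hx
    rw [dist_comm, dist_eq_norm]
    refine lt_of_le_of_lt ((pi_norm_le_iff_of_nonneg (by positivity)).2 fun i => ?_) hn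
    refine (hclose n x hx i).trans (mul_le_of_le_one_right (by positivity) ?_)
    exact inv_le_one_of_one_le₀ (one_le_pow₀ (hρ x hx))
  have hwan : AnalyticOnNhd ℂ w Ω :=
    analyticOnNhd_of_tendstoUniformlyOn hΩ (fun n => (hmain n).1.1) hunif
  have hwW : ∀ x ∈ Ω, WeightedLE M (rho x.2) 1 (w x) := by
    intro x hx
    have := ((hmain 0).2.1 x hx).sub (hclose 0 x hx)
    simpa using this
  have hwA : Adm w := ⟨hwan.differentiableOn, hwW⟩
  have hfix : ∀ x ∈ Ω, w x = T w x := by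
    intro x hx
    ext i
    refine tendsto_nhds_unique ((tendsto_add_atTop_iff_nat 1).2 (hw x hx i)) ?_
    rw [tendsto_iff_norm_sub_tendsto_zero]
    refine squeeze_zero (fun _ => norm_nonneg _)
      (g := fun n : ℕ => (1 / 2 : ℝ) ^ n * (1 / 2 * (rho x.2 ^ (M + coordWeight i))⁻¹))
      (fun n => ?_) ?_
    · have := hTlip _ _ (hmain n).1 hwA _ (by positivity) (hclose n) x hx i
      rw [← hvs] at this
      exact this.trans_eq (by ring)
    · rw [← zero_mul (1 / 2 * (rho x.2 ^ (M + coordWeight i))⁻¹)]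
      exact (tendsto_pow_atTop_nhds_zero_of_lt_one (by norm_num) (by norm_num)).mul_const _
  refine ⟨w, hwan, hwW, fun x hx => ?_⟩
  have hev : w =ᶠ[𝓝 x] T w := by
    filter_upwards [hΩ.mem_nhds hx] with y hy using hfix y hy
  have hTd : DifferentiableAt ℂ (T w) x := (hTdiff w hwA).differentiableAt (hΩ.mem_nhds hx)
  rw [hev.fderiv_eq]
  ext i
  have hpi : fderiv ℂ (fun y => T w y i) x (1, 1) = fderiv ℂ (T w) x (1, 1) i := by
    rw [fderiv_apply hTd i]; rfl
  rw [← hpi]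
  exact fderiv_charInt_apply hκ hκ0 hR0 (by positivity)
    (differentiableOn_pi.1 (hdiff w hwA.1 hwA.2) i)
    (fun y hy => weightedLE_succ_iff.1 (hbd w hwA y hy) i) hx

/-! ### Trigonometric polynomials on a strip -/

theorem IsTrigPoly.differentiable {f : ℂ → ℂ} (hf : IsTrigPoly f) : Differentiable ℂ f := by
  obtain ⟨n, a, b, h⟩ := hf
  rw [funext h]
  fun_prop

theorem IsTrigPoly.periodic {f : ℂ → ℂ} (hf : IsTrigPoly f) (φ : ℂ) :
    f (φ + 2 * Real.pi) = f φ := by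
  obtain ⟨n, a, b, h⟩ := hf
  have hc : ∀ k : ℕ, Complex.cos (k * (φ + 2 * Real.pi)) = Complex.cos (k * φ) := fun k => by
    rw [mul_add]; exact Complex.cos_add_nat_mul_two_pi _ k
  have hs : ∀ k : ℕ, Complex.sin (k * (φ + 2 * Real.pi)) = Complex.sin (k * φ) := fun k => by
    rw [mul_add]; exact Complex.sin_add_nat_mul_two_pi _ k
  simp only [h, hc, hs]

theorem norm_exp_mul_I_le {z : ℂ} {y : ℝ} (hz : |z.im| ≤ y) :
    ‖Complex.exp (z * Complex.I)‖ ≤ Real.exp y := by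
  rw [Complex.norm_exp]
  simp only [Complex.mul_re, Complex.I_re, Complex.I_im, mul_zero, mul_one, zero_sub]
  exact Real.exp_le_exp.2 ((neg_le_abs _).trans hz)

theorem norm_cos_le {z : ℂ} {y : ℝ} (hz : |z.im| ≤ y) : ‖Complex.cos z‖ ≤ Real.exp y := by
  have h1 := norm_exp_mul_I_le hz
  have h2 : ‖Complex.exp (-z * Complex.I)‖ ≤ Real.exp y := norm_exp_mul_I_le (by simpa using hz)
  have h3 := norm_add_le (Complex.exp (z * Complex.I)) (Complex.exp (-z * Complex.I))
  rw [Complex.cos, norm_div]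
  simp only [Complex.norm_ofNat]
  linarith

theorem norm_sin_le {z : ℂ} {y : ℝ} (hz : |z.im| ≤ y) : ‖Complex.sin z‖ ≤ Real.exp y := by
  have h1 := norm_exp_mul_I_le hz
  have h2 : ‖Complex.exp (-z * Complex.I)‖ ≤ Real.exp y := norm_exp_mul_I_le (by simpa using hz)
  have h3 := norm_sub_le (Complex.exp (-z * Complex.I)) (Complex.exp (z * Complex.I))
  rw [Complex.sin, norm_div, norm_mul, Complex.norm_I, mul_one]
  simp only [Complex.norm_ofNat]
  linarith

theorem IsTrigPoly.bounded {f : ℂ → ℂ} (hf : IsTrigPoly f) (h : ℝ) :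
    ∃ B : ℝ, ∀ φ ∈ strip h, ‖f φ‖ ≤ B := by
  obtain ⟨n, a, b, hfe⟩ := hf
  refine ⟨‖a 0‖ + ∑ k ∈ Finset.Icc 1 n, ‖a k‖ * Real.exp (k * h)
    + ∑ k ∈ Finset.Icc 1 n, ‖b k‖ * Real.exp (k * h), fun φ hφ => ?_⟩
  have him : ∀ k : ℕ, |((k : ℂ) * φ).im| ≤ k * h := fun k => by
    have : ((k : ℂ) * φ).im = k * φ.im := by simp
    rw [this, abs_mul, Nat.abs_cast]
    exact mul_le_mul_of_nonneg_left (le_of_lt hφ) (Nat.cast_nonneg k)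
  rw [hfe]
  refine (norm_add₃_le).trans (add_le_add (add_le_add le_rfl ?_) ?_)
  · refine norm_sum_le_of_le _ fun k _ => ?_
    rw [norm_mul]
    exact mul_le_mul_of_nonneg_left (norm_cos_le (him k)) (norm_nonneg _)
  · refine norm_sum_le_of_le _ fun k _ => ?_
    rw [norm_mul]
    exact mul_le_mul_of_nonneg_left (norm_sin_le (him k)) (norm_nonneg _)

/-- The properties of the coefficients of a formal separatrix that the construction relies on. -/
structure IsAdmissibleCoeff (c : ℕ → ℂ → Phase) : Prop where
  differentiable : ∀ k, Differentiable ℂ (c k)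
  periodic : ∀ k φ, c k (φ + 2 * Real.pi) = c k φ
  bounded : ∀ k h, ∃ B : ℝ, ∀ φ ∈ strip h, ‖c k φ‖ ≤ B
  form : ∀ k i, k < coordWeight i → ∀ φ, c k φ i = 0

theorem IsFormalSeparatrix.isAdmissibleCoeff {H : Phase → ℂ} {c : ℕ → ℂ → Phase}
    (hc : IsFormalSeparatrix H c) : IsAdmissibleCoeff c where
  differentiable k := differentiable_pi.2 fun i => (hc.trig k i).differentiable
  periodic k φ := funext fun i => (hc.trig k i).periodic φ
  bounded k h := by
    choose B hB using fun i => (hc.trig k i).bounded h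
    refine ⟨∑ i, |B i|, fun φ hφ => ?_⟩
    refine (pi_norm_le_iff_of_nonneg (by positivity)).2 fun i => ?_
    exact (hB i φ hφ).trans ((le_abs_self _).trans
      (Finset.single_le_sum (f := fun i => |B i|) (fun j _ => abs_nonneg _) (Finset.mem_univ i)))
  form := hc.form

namespace IsAdmissibleCoeff

variable {c : ℕ → ℂ → Phase}

theorem zero (hc : IsAdmissibleCoeff c) (φ : ℂ) : c 0 φ = 0 :=
  funext fun i => hc.form 0 i (coordWeight_pos i) φ

theorem bounded_le (hc : IsAdmissibleCoeff c) (N : ℕ) (h : ℝ) :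
    ∃ B : ℝ, 0 ≤ B ∧ ∀ k ≤ N, ∀ φ ∈ strip h, ‖c k φ‖ ≤ B := by
  choose B hB using fun k => hc.bounded k h
  refine ⟨∑ k ∈ Finset.range (N + 1), |B k|, by positivity, fun k hk φ hφ => ?_⟩
  exact (hB k φ hφ).trans ((le_abs_self _).trans
    (Finset.single_le_sum (f := fun i => |B i|) (fun j _ => abs_nonneg _) (by simp; omega)))

theorem deriv_bounded_le (hc : IsAdmissibleCoeff c) (N : ℕ) (h : ℝ) :
    ∃ B : ℝ, 0 ≤ B ∧ ∀ k ≤ N, ∀ φ ∈ strip h, ‖deriv (c k) φ‖ ≤ B := by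
  obtain ⟨B, hB0, hB⟩ := hc.bounded_le N (h + 2)
  refine ⟨B, hB0, fun k hk φ hφ => ?_⟩
  have := Complex.norm_deriv_le_of_forall_mem_sphere_norm_le (f := c k) (c := φ) (C := B)
    zero_lt_one (hc.differentiable k).diffContOnCl fun z hz => hB k hk z ?_
  · simpa using this
  · have h1 : |(z - φ).im| ≤ 1 := (Complex.abs_im_le_norm _).trans (by
      rw [← dist_eq_norm]; exact le_of_eq hz)
    have h2 : |φ.im| < h := hφ
    have h3 : z.im = φ.im + (z - φ).im := by simp
    show |z.im| < h + 2
    rw [h3]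
    exact (abs_add_le _ _).trans_lt (by linarith)

end IsAdmissibleCoeff

/-! ### Truncations of a formal solution -/

/-- The `N`-th partial sum of the formal series. -/
noncomputable def trunc (c : ℕ → ℂ → Phase) (N : ℕ) (x : ℂ × ℂ) : Phase :=
  ∑ k ∈ Finset.Icc 1 N, (x.2 ^ k)⁻¹ • c k x.1

/-- The symmetric power series of an analytic map, given by its iterated derivatives. -/
noncomputable def symmTaylor (X : Phase → Phase) : FormalMultilinearSeries ℂ Phase Phase :=
  fun l => ((l.factorial : ℂ))⁻¹ • iteratedFDeriv ℂ l X 0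

theorem hasFPowerSeriesAt_symmTaylor {X : Phase → Phase} (hX : AnalyticAt ℂ X 0) :
    HasFPowerSeriesAt X (symmTaylor X) 0 := by
  obtain ⟨p, r, hp⟩ := hX
  refine ⟨r, ⟨hp.r_le.trans ?_, hp.r_pos, fun {y} hy => ?_⟩⟩
  · refine FormalMultilinearSeries.radius_le_of_le fun l => ?_
    have hl : (0 : ℝ) < (l.factorial : ℝ) := by exact_mod_cast l.factorial_pos
    rw [symmTaylor, norm_smul, norm_inv, Complex.norm_natCast, inv_mul_le_iff₀ hl]
    refine ContinuousMultilinearMap.opNorm_le_bound (by positivity) fun v => ?_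
    rw [hp.iteratedFDeriv_eq_sum_of_completeSpace v]
    refine (norm_sum_le_of_le (f := fun σ : Equiv.Perm (Fin l) => p l fun i => v (σ i))
      (n := fun _ => ‖p l‖ * ∏ i, ‖v i‖) _ fun σ _ => ?_).trans_eq ?_
    · refine ((p l).le_opNorm _).trans_eq ?_
      rw [Equiv.prod_comp σ fun i => ‖v i‖]
    · simp [Finset.card_univ, Fintype.card_perm, mul_assoc]
  · exact hp.hasSum_iteratedFDeriv hy

/-- The power series in `z` of the polynomial `∑_{k ≤ N} zᵏ cₖ`. -/
noncomputable def polySeries (a : ℕ → Phase) (N : ℕ) : FormalMultilinearSeries ℂ ℂ Phase :=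
  fun k => if k ≤ N then ContinuousMultilinearMap.mkPiRing ℂ (Fin k) (a k) else 0

theorem hasFPowerSeriesAt_polySeries {a : ℕ → Phase} (ha : a 0 = 0) (N : ℕ) :
    HasFPowerSeriesAt (fun z : ℂ => ∑ k ∈ Finset.Icc 1 N, z ^ k • a k) (polySeries a N) 0 := by
  rw [hasFPowerSeriesAt_iff]
  refine Eventually.of_forall fun z => ?_
  have hcoef : ∀ k, (polySeries a N).coeff k = if k ≤ N then a k else 0 := fun k => by
    simp only [FormalMultilinearSeries.coeff, polySeries]
    split_ifs <;> simp
  have h1 := hasSum_sum_of_ne_finset_zero (f := fun k => z ^ k • (polySeries a N).coeff k)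
    (s := Finset.Icc 1 N) (L := SummationFilter.unconditional ℕ) fun k hk => by
      rw [hcoef]
      split_ifs with h
      · have : k = 0 := by simp at hk; omega
        simp [this, ha]
      · simp
  convert! h1 using 1
  rw [zero_add]
  refine Finset.sum_congr rfl fun k hk => ?_
  rw [hcoef, if_pos (Finset.mem_Icc.1 hk).2]

theorem comp_polySeries_apply (X : Phase → Phase) (c : ℕ → ℂ → Phase) {n N : ℕ} (hn : n ≤ N)
    (φ z : ℂ) : ((symmTaylor X).comp (polySeries (fun k => c k φ) N)) n (fun _ => z) =
      z ^ n • formalSubst X c n φ := by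
  simp only [FormalMultilinearSeries.comp, sum_apply, formalSubst,
    Finset.smul_sum]
  refine Finset.sum_congr rfl fun s _ => ?_
  rw [FormalMultilinearSeries.compAlongComposition_apply]
  have h1 : (polySeries (fun k => c k φ) N).applyComposition s (fun _ => z) =
      fun j => z ^ s.blocksFun j • c (s.blocksFun j) φ := by
    ext1 j
    have hj : s.blocksFun j ≤ N := (s.blocksFun_le j).trans hn
    simp [FormalMultilinearSeries.applyComposition, polySeries, hj]
  rw [h1, symmTaylor, smul_apply, ContinuousMultilinearMap.map_smul_univ,
    Finset.prod_pow_eq_pow_sum, s.sum_blocksFun, smul_comm]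

/-- The residual of the truncation in the variable `z = τ⁻¹`. -/
noncomputable def truncResidual (X : Phase → Phase) (c : ℕ → ℂ → Phase) (N : ℕ) (φ z : ℂ) : Phase :=
  (∑ k ∈ Finset.Icc 1 N, (z ^ k • deriv (c k) φ - ((k : ℂ) * z ^ (k + 1)) • c k φ)) -
    X (∑ k ∈ Finset.Icc 1 N, z ^ k • c k φ)

theorem sum_formalD (c : ℕ → ℂ → Phase) (hc : ∀ φ, c 0 φ = 0) (N : ℕ) (φ z : ℂ) :
    ∑ k ∈ Finset.Icc 1 N, (z ^ k • deriv (c k) φ - ((k : ℂ) * z ^ (k + 1)) • c k φ) =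
      ∑ n ∈ Finset.range (N + 1), z ^ n • formalD c n φ - ((N : ℂ) * z ^ (N + 1)) • c N φ := by
  have h0 : c 0 = fun _ => 0 := funext hc
  induction N with
  | zero => simp [formalD, h0]
  | succ N ih =>
    rw [Finset.sum_Icc_succ_top (by omega), ih, Finset.sum_range_succ _ (N + 1)]
    simp only [formalD, smul_sub, smul_smul]
    rw [mul_comm (z ^ (N + 1)) (N : ℂ)]
    push_cast
    abel

theorem residual_isBigO {X : Phase → Phase} (hX : AnalyticAt ℂ X 0) {c : ℕ → ℂ → Phase}
    (hc : ∀ φ, c 0 φ = 0) (hsol : ∀ n φ, formalD c n φ = formalSubst X c n φ) (N : ℕ) (φ : ℂ) :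
    truncResidual X c N φ =O[𝓝 0] fun z => ‖z‖ ^ (N + 1) := by
  have hγ := hasFPowerSeriesAt_polySeries (a := fun k => c k φ) (hc φ) N
  have hγ0 : (∑ k ∈ Finset.Icc 1 N, (0 : ℂ) ^ k • c k φ) = 0 :=
    Finset.sum_eq_zero fun k hk => by
      rw [zero_pow (by have := (Finset.mem_Icc.1 hk).1; omega), zero_smul]
  have hp : HasFPowerSeriesAt X (symmTaylor X) (∑ k ∈ Finset.Icc 1 N, (0 : ℂ) ^ k • c k φ) := by
    rw [hγ0]; exact hasFPowerSeriesAt_symmTaylor hX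
  have h1 := (HasFPowerSeriesAt.comp (f := fun z : ℂ => ∑ k ∈ Finset.Icc 1 N, z ^ k • c k φ)
    hp hγ).isBigO_sub_partialSum_pow (N + 1)
  have h2 : (fun z : ℂ => ((N : ℂ) * z ^ (N + 1)) • c N φ) =O[𝓝 0] fun z => ‖z‖ ^ (N + 1) := by
    refine Asymptotics.IsBigO.of_bound (‖(N : ℂ)‖ * ‖c N φ‖) (Eventually.of_forall fun z => ?_)
    simp only [norm_smul, norm_mul, norm_pow, norm_norm]
    exact le_of_eq (by ring)
  refine (h1.add h2).neg_left.congr_left fun z => ?_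
  have h3 : ((symmTaylor X).comp (polySeries (fun k => c k φ) N)).partialSum (N + 1) z =
      ∑ n ∈ Finset.range (N + 1), z ^ n • formalD c n φ :=
    Finset.sum_congr rfl fun n hn => by
      rw [comp_polySeries_apply X c (by simp at hn; omega), hsol]
  rw [h3, truncResidual, sum_formalD c hc]
  simp only [Function.comp_apply, zero_add]
  abel

/-- The residual is of order `N + 1`, uniformly on the strip: it is holomorphic and uniformly
bounded on a fixed disc around `z = 0`, and vanishes there to order `N + 1`. -/
theorem exists_residual_le {X : Phase → Phase} (hX : AnalyticAt ℂ X 0) {c : ℕ → ℂ → Phase}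
    (hc : IsAdmissibleCoeff c) (hsol : ∀ n φ, formalD c n φ = formalSubst X c n φ) (N : ℕ) (h : ℝ) :
    ∃ C : ℝ, ∃ ε > 0, ∀ φ ∈ strip h, ∀ z : ℂ, ‖z‖ < ε →
      ‖truncResidual X c N φ z‖ ≤ C * ‖z‖ ^ (N + 1) := by
  obtain ⟨B, hB0, hB⟩ := hc.bounded_le N h
  obtain ⟨B', hB'0, hB'⟩ := hc.deriv_bounded_le N h
  obtain ⟨δ, hδ, hXδ⟩ : ∃ δ > 0, ∀ y ∈ ball (0 : Phase) δ,
      AnalyticAt ℂ X y ∧ ‖X y‖ < ‖X 0‖ + 1 := by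
    refine Metric.eventually_nhds_iff_ball.1 (hX.eventually_analyticAt.and ?_)
    exact hX.continuousAt.norm.eventually (gt_mem_nhds (lt_add_one _))
  have hM : 0 < δ / (N * B + 1) := by positivity
  let ε := min 1 (δ / (N * B + 1))
  have hε : 0 < ε := lt_min one_pos hM
  have hγ : ∀ φ ∈ strip h, ∀ z : ℂ, ‖z‖ < ε →
      (∑ k ∈ Finset.Icc 1 N, z ^ k • c k φ) ∈ ball (0 : Phase) δ := by
    intro φ hφ z hz
    have hz1 : ‖z‖ ≤ 1 := (hz.trans_le (min_le_left _ _)).le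
    rw [mem_ball_zero_iff]
    have h1 : ‖∑ k ∈ Finset.Icc 1 N, z ^ k • c k φ‖ ≤ ∑ k ∈ Finset.Icc 1 N, ‖z‖ * B := by
      refine norm_sum_le_of_le _ fun k hk => ?_
      obtain ⟨hk1, hk2⟩ := Finset.mem_Icc.1 hk
      rw [norm_smul, norm_pow]
      refine mul_le_mul ?_ (hB k hk2 φ hφ) (norm_nonneg _) (norm_nonneg _)
      exact pow_le_of_le_one (norm_nonneg _) hz1 (by omega)
    refine h1.trans_lt ?_
    have h2 : ‖z‖ * (N * B + 1) < δ :=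
      (lt_div_iff₀ (by positivity)).1 (hz.trans_le (min_le_right _ _))
    simp only [Finset.sum_const, Nat.card_Icc, add_tsub_cancel_right, nsmul_eq_mul]
    nlinarith [norm_nonneg z]
  have hR : ∀ φ ∈ strip h, ∀ z : ℂ, ‖z‖ < ε →
      ‖truncResidual X c N φ z‖ ≤ N * (B' + N * B) + (‖X 0‖ + 1) := by
    intro φ hφ z hz
    have hz1 : ‖z‖ ≤ 1 := (hz.trans_le (min_le_left _ _)).le
    refine (norm_sub_le _ _).trans (add_le_add ?_ (hXδ _ (hγ φ hφ z hz)).2.le)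
    refine (norm_sum_le_of_le (n := fun _ => B' + N * B) _ fun k hk => ?_).trans_eq (by simp; ring)
    obtain ⟨hk1, hk2⟩ := Finset.mem_Icc.1 hk
    refine (norm_sub_le _ _).trans (add_le_add ?_ ?_)
    · rw [norm_smul, norm_pow]
      exact (mul_le_of_le_one_left (norm_nonneg _) (pow_le_one₀ (norm_nonneg _) hz1)).trans
        (hB' k hk2 φ hφ)
    · rw [norm_smul, norm_mul, norm_pow, Complex.norm_natCast]
      have h1 : ‖z‖ ^ (k + 1) ≤ 1 := pow_le_one₀ (norm_nonneg _) hz1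
      have h2 : (k : ℝ) ≤ N := by exact_mod_cast hk2
      have h3 : (k : ℝ) * ‖z‖ ^ (k + 1) ≤ N := by nlinarith [Nat.cast_nonneg (α := ℝ) k]
      exact mul_le_mul h3 (hB k hk2 φ hφ) (norm_nonneg _) (Nat.cast_nonneg _)
  refine ⟨(N * (B' + N * B) + (‖X 0‖ + 1)) / ε ^ (N + 1), ε, hε, fun φ hφ z hz => ?_⟩
  have hO := residual_isBigO hX hc.zero hsol N φ
  have h0 : truncResidual X c N φ 0 = 0 := by
    refine Asymptotics.IsBigO.eq_zero_of_norm_pow (x₀ := (0 : ℂ)) (n := N + 1) ?_ (by omega)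
    simpa only [sub_zero] using hO
  have hd : DifferentiableOn ℂ (truncResidual X c N φ) (ball 0 ε) := by
    intro z hz
    have hz' : ‖z‖ < ε := by simpa using hz
    have h1 := (hXδ _ (hγ φ hφ z hz')).1.differentiableAt
    have h2 : DifferentiableAt ℂ (fun z : ℂ => ∑ k ∈ Finset.Icc 1 N, z ^ k • c k φ) z := by fun_prop
    have h3 : DifferentiableAt ℂ (fun z : ℂ => ∑ k ∈ Finset.Icc 1 N,
      (z ^ k • deriv (c k) φ - ((k : ℂ) * z ^ (k + 1)) • c k φ)) z := by fun_prop
    exact (h3.sub (h1.comp z h2)).differentiableWithinAt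
  have hlo : (fun w => truncResidual X c N φ w - truncResidual X c N φ 0) =o[𝓝 0]
      fun w => ‖w - 0‖ ^ N := by
    simp only [h0, sub_zero]
    refine hO.trans_isLittleO ?_
    exact (Asymptotics.isLittleO_pow_pow (𝕜 := ℝ) (Nat.lt_succ_self N)).comp_tendsto
      (tendsto_norm_zero (E := ℂ))
  have := Complex.dist_le_mul_div_pow_of_mapsTo_ball_of_isLittleO hd
    (R₂ := N * (B' + N * B) + (‖X 0‖ + 1)) (fun w hw => by
      rw [h0, mem_closedBall_zero_iff]; exact hR φ hφ w (by simpa using hw)) hlo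
    (z := z) (by simpa using hz)
  rw [h0, dist_zero_right, dist_zero_right, div_pow] at this
  exact this.trans_eq (by ring)

theorem hasDerivAt_comp_line {f : ℂ × ℂ → Phase} {x : ℂ × ℂ} {z : ℂ}
    (hf : DifferentiableAt ℂ f (x + z • ((1 : ℂ), (1 : ℂ)))) :
    HasDerivAt (fun s : ℂ => f (x + s • ((1 : ℂ), (1 : ℂ))))
      (fderiv ℂ f (x + z • ((1 : ℂ), (1 : ℂ))) (1, 1)) z := by
  have hl : HasDerivAt (fun s : ℂ => x + s • ((1 : ℂ), (1 : ℂ))) (1, 1) z := by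
    simpa using ((hasDerivAt_id z).smul_const ((1 : ℂ), (1 : ℂ))).const_add x
  exact HasFDerivAt.comp_hasDerivAt (l := f) z hf.hasFDerivAt hl

theorem IsAdmissibleCoeff.analyticAt_trunc {c : ℕ → ℂ → Phase}
    (hc : IsAdmissibleCoeff c) (N : ℕ) {x : ℂ × ℂ} (hx : x.2 ≠ 0) :
    AnalyticAt ℂ (trunc c N) x := by
  refine Finset.analyticAt_fun_sum _ fun k _ => ?_
  refine AnalyticAt.fun_smul (f := fun x : ℂ × ℂ => (x.2 ^ k)⁻¹)
    (g := fun x : ℂ × ℂ => c k x.1) ?_ ?_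
  · exact (analyticAt_snd.pow k).inv (pow_ne_zero k hx)
  · have h1 : AnalyticAt ℂ (c k) x.1 := (hc.differentiable k).analyticAt _
    exact AnalyticAt.fun_comp (f := fun x : ℂ × ℂ => x.1) h1 analyticAt_fst

theorem fderiv_trunc_apply {c : ℕ → ℂ → Phase} (hc : IsAdmissibleCoeff c) (N : ℕ) {x : ℂ × ℂ}
    (hx : x.2 ≠ 0) : fderiv ℂ (trunc c N) x (1, 1) = ∑ k ∈ Finset.Icc 1 N,
      ((x.2⁻¹) ^ k • deriv (c k) x.1 - ((k : ℂ) * (x.2⁻¹) ^ (k + 1)) • c k x.1) := by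
  -- differentiate along the characteristic through `x`
  have e0 : x + (0 : ℂ) • ((1 : ℂ), (1 : ℂ)) = x := by simp
  have h1 := hasDerivAt_comp_line (f := trunc c N) (x := x) (z := 0)
    (by rw [e0]; exact (hc.analyticAt_trunc N hx).differentiableAt)
  rw [e0] at h1
  refine h1.unique ?_
  simp only [trunc]
  refine HasDerivAt.fun_sum fun k _ => ?_
  have ha : HasDerivAt (fun s : ℂ => x.1 + s) 1 0 := by
    simpa using (hasDerivAt_id (0 : ℂ)).const_add x.1
  have hb : HasDerivAt (fun s : ℂ => x.2 + s) 1 0 := by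
    simpa using (hasDerivAt_id (0 : ℂ)).const_add x.2
  have hck : HasDerivAt (fun s : ℂ => c k (x.1 + s)) (deriv (c k) x.1) 0 := by
    have := HasDerivAt.scomp (0 : ℂ) (h := fun s : ℂ => x.1 + s) (g₁ := c k)
      (g₁' := deriv (c k) x.1) (by rw [add_zero]; exact (hc.differentiable k x.1).hasDerivAt) ha
    rwa [one_smul] at this
  have hpow := (hb.fun_pow k).fun_inv (by simpa using pow_ne_zero k hx)
  have := hpow.fun_smul hck
  simp only [Prod.fst_add, Prod.snd_add, Prod.smul_fst, Prod.smul_snd, smul_eq_mul, mul_one]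
  refine this.congr_deriv ?_
  simp only [add_zero, mul_one]
  rw [inv_pow, sub_eq_add_neg, ← neg_smul]
  congr 2
  rcases k with _ | k
  · simp
  · simp only [Nat.add_sub_cancel]
    rw [inv_pow]
    field_simp
    ring

/-- The truncations of the formal series solve `𝒟Γ = X(Γ)` up to errors of increasing order. -/
def IsAsymptoticSolution (h : ℝ) (X : Phase → Phase) (c : ℕ → ℂ → Phase) : Prop :=
  ∀ N, ∃ C > 0, ∃ R > 0, ∀ x : ℂ × ℂ, x.1 ∈ strip h → R < ‖x.2‖ →
    ‖fderiv ℂ (trunc c N) x (1, 1) - X (trunc c N x)‖ ≤ C * (‖x.2‖ ^ (N + 1))⁻¹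

theorem isAsymptoticSolution_of_formalD_eq {X : Phase → Phase} (hX : AnalyticAt ℂ X 0)
    {c : ℕ → ℂ → Phase} (hc : IsAdmissibleCoeff c)
    (hsol : ∀ n φ, formalD c n φ = formalSubst X c n φ) (h : ℝ) :
    IsAsymptoticSolution h X c := by
  intro N
  obtain ⟨C, ε, hε, hC⟩ := exists_residual_le hX hc hsol N h
  refine ⟨|C| + 1, by positivity, ε⁻¹, by positivity, fun x hx hR => ?_⟩
  have hpos : 0 < ‖x.2‖ := lt_trans (by positivity) hR
  have hne : x.2 ≠ 0 := norm_pos_iff.1 hpos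
  have h1 := hC x.1 hx x.2⁻¹ (by rw [norm_inv]; exact inv_lt_of_inv_lt₀ hε hR)
  rw [fderiv_trunc_apply hc N hne]
  simp only [truncResidual, inv_pow, norm_inv] at h1
  simp only [trunc, inv_pow]
  refine h1.trans ?_
  gcongr
  exact (le_abs_self C).trans (by linarith)

/-! ### Weighted Lipschitz estimates for the vector field -/

theorem WeightedLE.norm_le {ρ A : ℝ} {y : Phase} (hA : 0 ≤ A) (hρ : 1 ≤ ρ)
    (hy : WeightedLE 0 ρ A y) : ‖y‖ ≤ A * ρ⁻¹ := by
  refine (pi_norm_le_iff_of_nonneg (by positivity)).2 fun i => (hy i).trans ?_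
  gcongr
  simpa using pow_le_pow_right₀ hρ (coordWeight_pos i)

theorem phase_eq_sum (v : Phase) : v = ∑ i, v i • (Pi.single i 1 : Phase) := by
  ext j
  simp [Finset.sum_apply, Pi.single_apply]

theorem map_phase_eq_sum (L : Phase →L[ℂ] ℂ) (v : Phase) : L v = ∑ i, v i * L (Pi.single i 1) := by
  conv_lhs => rw [phase_eq_sum v]
  simp [map_sum]

/-- A function whose Taylor series at `0` has weighted order at least `3` is Lipschitz with constant
`O(ρ⁻³)` with respect to the weighted distance: its derivatives are `O(ρ⁻¹)` in the directions of
weight `2` and `O(ρ⁻²)` in those of weight `1`. -/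
theorem exists_weighted_lipschitz {g : Phase → ℂ} (hg : AnalyticAt ℂ g 0) (h1 : fderiv ℂ g 0 = 0)
    (h2 : ∀ i j, coordWeight i = 1 → coordWeight j = 1 →
      fderiv ℂ (fun y => fderiv ℂ g y (Pi.single i 1)) 0 (Pi.single j 1) = 0) (A : ℝ) (hA : 0 < A) :
    ∃ C ≥ 0, ∃ ρ₀ ≥ 1, ∀ ρ ≥ ρ₀, ∀ y y', WeightedLE 0 ρ A y → WeightedLE 0 ρ A y' → ∀ a ≥ 0,
      WeightedLE 0 ρ a (y - y') → ‖g y - g y'‖ ≤ C * a * (ρ ^ 3)⁻¹ := by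
  let gi : Fin 4 → Phase → ℂ := fun i y => fderiv ℂ g y (Pi.single i 1)
  have hgi : ∀ i, AnalyticAt ℂ (gi i) 0 := fun i =>
    ((ContinuousLinearMap.apply ℂ ℂ (Pi.single i 1 : Phase)).analyticAt _).comp hg.fderiv
  have hgi0 : ∀ i, gi i 0 = 0 := fun i => by simp [gi, h1]
  have hO : ∀ i, (fun y => gi i y - fderiv ℂ (gi i) 0 y) =O[𝓝 0] fun y => ‖y‖ ^ 2 := by
    intro i
    obtain ⟨p, hp⟩ := hgi i
    have := hp.isBigO_sub_partialSum_pow 2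
    refine this.congr_left fun y => ?_
    rw [hp.fderiv_eq]
    have hp0 : p 0 (fun _ => y) = 0 := by
      rw [← hgi0 i, ← hp.coeff_zero fun _ => y]
    simp [FormalMultilinearSeries.partialSum, Finset.sum_range_succ, hp0]
    exact congrArg (p 1) (funext fun j => by fin_cases j; rfl)
  have hO1 : ∀ i, gi i =O[𝓝 0] fun y => ‖y‖ := by
    intro i
    have := (hgi i).differentiableAt.hasFDerivAt.isBigO_sub
    simpa [hgi0 i] using this.norm_right
  obtain ⟨K, hK⟩ : ∃ K : ℝ, ∀ i, ∀ᶠ y in 𝓝 (0 : Phase), ‖gi i y‖ ≤ K * ‖y‖ ∧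
      ‖gi i y - fderiv ℂ (gi i) 0 y‖ ≤ K * ‖y‖ ^ 2 := by
    choose K1 hK1 using fun i => (hO1 i).bound
    choose K2 hK2 using fun i => (hO i).bound
    refine ⟨∑ i, (|K1 i| + |K2 i|), fun i => ?_⟩
    have hs := Finset.single_le_sum (f := fun i => |K1 i| + |K2 i|) (fun j _ => by positivity)
      (Finset.mem_univ i)
    filter_upwards [hK1 i, hK2 i] with y h1 h2
    rw [norm_norm] at h1
    rw [norm_pow, norm_norm] at h2
    constructor
    · refine h1.trans (mul_le_mul_of_nonneg_right ?_ (norm_nonneg _))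
      linarith [le_abs_self (K1 i), abs_nonneg (K2 i)]
    · refine h2.trans (mul_le_mul_of_nonneg_right ?_ (by positivity))
      linarith [le_abs_self (K2 i), abs_nonneg (K1 i)]
  obtain ⟨r, hr, hball⟩ : ∃ r > 0, ∀ y ∈ ball (0 : Phase) r, AnalyticAt ℂ g y ∧
      ∀ i, ‖gi i y‖ ≤ K * ‖y‖ ∧ ‖gi i y - fderiv ℂ (gi i) 0 y‖ ≤ K * ‖y‖ ^ 2 :=
    Metric.eventually_nhds_iff_ball.1 (hg.eventually_analyticAt.and (eventually_all.2 hK))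
  let B : ℝ := ∑ i, ∑ j, ‖fderiv ℂ (gi i) 0 (Pi.single j 1)‖
  have hB : ∀ i j, ‖fderiv ℂ (gi i) 0 (Pi.single j 1)‖ ≤ B := fun i j =>
    (Finset.single_le_sum (f := fun j => ‖fderiv ℂ (gi i) 0 (Pi.single j 1)‖)
      (fun j _ => norm_nonneg _) (Finset.mem_univ j)).trans
    (Finset.single_le_sum (f := fun i => ∑ j, ‖fderiv ℂ (gi i) 0 (Pi.single j 1)‖)
      (fun j _ => by positivity) (Finset.mem_univ i))
  have hB0 : 0 ≤ B := by positivity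
  let C₁ : ℝ := |K| * A + (4 * (A * B) + |K| * A ^ 2)
  refine ⟨4 * C₁, by positivity, A / r + 1, by simp; positivity, fun ρ hρ y y' hy hy' a ha hd => ?_⟩
  have hAr : 0 < A / r := by positivity
  have hρ1 : 1 ≤ ρ := by linarith
  have hρ0 : 0 < ρ := by linarith
  have hsmall : A * ρ⁻¹ < r := by
    rw [← div_eq_mul_inv, div_lt_iff₀ hρ0, mul_comm, ← div_lt_iff₀ hr]; linarith
  -- the partial derivatives in the tube
  have hpart : ∀ z, WeightedLE 0 ρ A z → AnalyticAt ℂ g z ∧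
      ∀ i, ‖gi i z‖ * (ρ ^ coordWeight i)⁻¹ ≤ C₁ * (ρ ^ 3)⁻¹ := by
    intro z hz
    have hzn := hz.norm_le hA.le hρ1
    obtain ⟨hz1, hz2⟩ := hball z (by simpa using hzn.trans_lt hsmall)
    refine ⟨hz1, fun i => ?_⟩
    have hcase : coordWeight i = 2 ∨ coordWeight i = 1 := by
      fin_cases i <;> simp [coordWeight]
    rcases hcase with hi | hi
    · have h3 : ‖gi i z‖ ≤ C₁ * ρ⁻¹ := by
        calc ‖gi i z‖ ≤ |K| * (A * ρ⁻¹) := (hz2 i).1.trans (by gcongr; exact le_abs_self K)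
          _ = |K| * A * ρ⁻¹ := by ring
          _ ≤ C₁ * ρ⁻¹ := by gcongr; exact le_add_of_nonneg_right (by positivity)
      rw [hi]
      calc ‖gi i z‖ * (ρ ^ 2)⁻¹ ≤ C₁ * ρ⁻¹ * (ρ ^ 2)⁻¹ := by gcongr
        _ = C₁ * (ρ ^ 3)⁻¹ := by field_simp
    · have h4 : ‖fderiv ℂ (gi i) 0 z‖ ≤ 4 * (A * B) * (ρ ^ 2)⁻¹ := by
        rw [map_phase_eq_sum]
        refine (norm_sum_le_of_le (n := fun _ => (A * (ρ ^ 2)⁻¹) * B) _ fun j _ => ?_).trans_eq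
          (by simp; ring)
        rw [norm_mul]
        have hjc : coordWeight j = 2 ∨ coordWeight j = 1 := by
          fin_cases j <;> simp [coordWeight]
        rcases hjc with hj | hj
        · have := hz j
          rw [hj] at this
          exact mul_le_mul (by simpa using this) (hB i j) (norm_nonneg _) (by positivity)
        · rw [h2 i j hi hj, norm_zero, mul_zero]
          positivity
      have h3 : ‖gi i z‖ ≤ C₁ * (ρ ^ 2)⁻¹ := by
        calc ‖gi i z‖ ≤ ‖fderiv ℂ (gi i) 0 z‖ + ‖gi i z - fderiv ℂ (gi i) 0 z‖ := by
              simpa using norm_add_le (fderiv ℂ (gi i) 0 z) (gi i z - fderiv ℂ (gi i) 0 z)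
          _ ≤ 4 * (A * B) * (ρ ^ 2)⁻¹ + |K| * (A * ρ⁻¹) ^ 2 := by
              refine add_le_add h4 ((hz2 i).2.trans ?_)
              gcongr
              exact le_abs_self K
          _ = (4 * (A * B) + |K| * A ^ 2) * (ρ ^ 2)⁻¹ := by ring
          _ ≤ C₁ * (ρ ^ 2)⁻¹ := by gcongr; exact le_add_of_nonneg_left (by positivity)
      rw [hi]
      calc ‖gi i z‖ * (ρ ^ 1)⁻¹ ≤ C₁ * (ρ ^ 2)⁻¹ * (ρ ^ 1)⁻¹ := by gcongr
        _ = C₁ * (ρ ^ 3)⁻¹ := by field_simp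
  have hseg : ∀ s ∈ Icc (0 : ℝ) 1, WeightedLE 0 ρ A (y' + s • (y - y')) := by
    intro s hs i
    have e : (y' + s • (y - y')) i = ((1 - s : ℝ) : ℂ) * y' i + (s : ℂ) * y i := by
      simp; ring
    rw [e]
    refine (norm_add_le _ _).trans ?_
    rw [norm_mul, norm_mul, Complex.norm_real, Complex.norm_real, Real.norm_of_nonneg hs.1,
      Real.norm_of_nonneg (by linarith [hs.2])]
    nlinarith [hy i, hy' i, hs.1, hs.2]
  have hderiv : ∀ s ∈ Icc (0 : ℝ) 1, HasDerivWithinAt (fun s : ℝ => g (y' + s • (y - y')))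
      (fderiv ℂ g (y' + s • (y - y')) (y - y')) (Icc 0 1) s := by
    intro s hs
    have e1 := (hpart _ (hseg s hs)).1.differentiableAt.hasFDerivAt.restrictScalars ℝ
    have e2 : HasDerivAt (fun s : ℝ => y' + s • (y - y')) (y - y') s := by
      simpa using ((hasDerivAt_id s).smul_const (y - y')).const_add y'
    exact (e1.comp_hasDerivAt s e2).hasDerivWithinAt
  have hbound : ∀ s ∈ Ico (0 : ℝ) 1,
      ‖fderiv ℂ g (y' + s • (y - y')) (y - y')‖ ≤ 4 * C₁ * a * (ρ ^ 3)⁻¹ := by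
    intro s hs
    have h5 := (hpart _ (hseg s (Ico_subset_Icc_self hs))).2
    rw [map_phase_eq_sum]
    refine (norm_sum_le_of_le (n := fun _ => a * (C₁ * (ρ ^ 3)⁻¹)) _ fun i _ => ?_).trans_eq
      (by simp; ring)
    rw [norm_mul]
    have h6 := hd i
    rw [zero_add] at h6
    calc ‖(y - y') i‖ * ‖gi i (y' + s • (y - y'))‖
        ≤ a * (ρ ^ coordWeight i)⁻¹ * ‖gi i (y' + s • (y - y'))‖ := by gcongr
      _ = a * (‖gi i (y' + s • (y - y'))‖ * (ρ ^ coordWeight i)⁻¹) := by ring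
      _ ≤ a * (C₁ * (ρ ^ 3)⁻¹) := mul_le_mul_of_nonneg_left (h5 i) ha
  have := norm_image_sub_le_of_norm_deriv_le_segment_01' hderiv hbound
  simpa using this

theorem norm_mul₃_sub_le {ρ A a : ℝ} (hρ : 1 ≤ ρ) (ha : 0 ≤ a) {y y' : Phase}
    (hA : 0 ≤ A) (hy : WeightedLE 0 ρ A y) (hy' : WeightedLE 0 ρ A y')
    (hd : WeightedLE 0 ρ a (y - y')) (i j k : Fin 4) (hi : coordWeight i = 1)
    (hj : coordWeight j = 1) (hk : coordWeight k = 1) :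
    ‖y i * y j * y k - y' i * y' j * y' k‖ ≤ 3 * A ^ 2 * a * (ρ ^ 3)⁻¹ := by
  have hρ0 : 0 < ρ := by linarith
  have b : ∀ {l : Fin 4} {b : ℝ} {v : Phase}, coordWeight l = 1 → WeightedLE 0 ρ b v →
      ‖v l‖ ≤ b * ρ⁻¹ := fun {l b v} hl hv => by
    have := hv l
    rwa [hl, zero_add, pow_one] at this
  have e : y i * y j * y k - y' i * y' j * y' k =
      (y - y') i * y j * y k + y' i * (y - y') j * y k + y' i * y' j * (y - y') k := by
    simp; ring
  rw [e]
  refine norm_add₃_le.trans ?_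
  simp only [norm_mul]
  have t1 : ‖(y - y') i‖ * ‖y j‖ * ‖y k‖ ≤ a * ρ⁻¹ * (A * ρ⁻¹) * (A * ρ⁻¹) := by
    gcongr
    exacts [b hi hd, b hj hy, b hk hy]
  have t2 : ‖y' i‖ * ‖(y - y') j‖ * ‖y k‖ ≤ A * ρ⁻¹ * (a * ρ⁻¹) * (A * ρ⁻¹) := by
    gcongr
    exacts [b hi hy', b hj hd, b hk hy]
  have t3 : ‖y' i‖ * ‖y' j‖ * ‖(y - y') k‖ ≤ A * ρ⁻¹ * (A * ρ⁻¹) * (a * ρ⁻¹) := by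
    gcongr
    exacts [b hi hy', b hj hy', b hk hd]
  refine (add_le_add (add_le_add t1 t2) t3).trans_eq ?_
  rw [← inv_pow]; ring

/-! ### The Hamiltonian vector field -/

theorem analyticOnNhd_coordDeriv {F : Phase → ℂ} {U : Set Phase} (hF : AnalyticOnNhd ℂ F U)
    (i : Fin 4) : AnalyticOnNhd ℂ (coordDeriv F i) U := fun x hx =>
  ((ContinuousLinearMap.apply ℂ ℂ (Pi.single i 1 : Phase)).analyticAt _).comp (hF x hx).fderiv

theorem analyticOnNhd_hamVF {H : Phase → ℂ} {U : Set Phase} (hH : AnalyticOnNhd ℂ H U) :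
    AnalyticOnNhd ℂ (hamVF H) U := by
  intro x hx
  rw [analyticAt_pi_iff]
  have h := fun i => analyticOnNhd_coordDeriv hH i x hx
  intro i
  fin_cases i
  · exact h 2
  · exact h 3
  · exact (h 0).neg
  · exact (h 1).neg

theorem fderiv_coordDeriv_apply {F : Phase → ℂ} {y : Phase} (hF : AnalyticAt ℂ F y) (i j : Fin 4) :
    fderiv ℂ (coordDeriv F i) y (Pi.single j 1) =
      iteratedFDeriv ℂ 2 F y ![Pi.single j 1, Pi.single i 1] := by
  rw [iteratedFDeriv_two_apply]
  have h := hF.fderiv.differentiableAt.hasFDerivAt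
  have := ((ContinuousLinearMap.apply ℂ ℂ (Pi.single i 1 : Phase)).hasFDerivAt.comp y h).fderiv
  have e : coordDeriv F i =
      ⇑(ContinuousLinearMap.apply ℂ ℂ (Pi.single i 1 : Phase)) ∘ fderiv ℂ F := rfl
  rw [e, this]
  simp

theorem fderiv_fderiv_coordDeriv_apply {F : Phase → ℂ} (hF : AnalyticAt ℂ F 0) (i j k : Fin 4) :
    fderiv ℂ (fun y => fderiv ℂ (coordDeriv F i) y (Pi.single j 1)) 0 (Pi.single k 1) =
      iteratedFDeriv ℂ 3 F 0 ![Pi.single k 1, Pi.single j 1, Pi.single i 1] := by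
  have hev : (fun y => fderiv ℂ (coordDeriv F i) y (Pi.single j 1)) =ᶠ[𝓝 0]
      fun y => iteratedFDeriv ℂ 2 F y ![Pi.single j 1, Pi.single i 1] := by
    filter_upwards [hF.eventually_analyticAt] with y hy using fderiv_coordDeriv_apply hy i j
  rw [hev.fderiv_eq, iteratedFDeriv_succ_apply_left,
    fderiv_continuousMultilinear_apply_const_apply
      ((AnalyticOnNhd.iteratedFDeriv (s := {0}) (by rintro x rfl; exact hF) 2)
        0 rfl).differentiableAt]
  rfl

theorem coordWeight_le_two (i : Fin 4) : coordWeight i ≤ 2 := by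
  fin_cases i <;> simp [coordWeight]

theorem exists_weighted_lipschitz_coordDeriv {F : Phase → ℂ} (hF : AnalyticAt ℂ F 0)
    (hord : HasWeightedOrderAtLeast 5 F) (A : ℝ) (hA : 0 < A) :
    ∃ C ≥ 0, ∃ ρ₀ ≥ 1, ∀ ρ ≥ ρ₀, ∀ y y', WeightedLE 0 ρ A y → WeightedLE 0 ρ A y' → ∀ a ≥ 0,
      WeightedLE 0 ρ a (y - y') →
      ∀ i, ‖coordDeriv F i y - coordDeriv F i y'‖ ≤ C * a * (ρ ^ 3)⁻¹ := by
  have key : ∀ i, ∃ C ≥ 0, ∃ ρ₀ ≥ 1, ∀ ρ ≥ ρ₀, ∀ y y', WeightedLE 0 ρ A y → WeightedLE 0 ρ A y' →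
      ∀ a ≥ 0, WeightedLE 0 ρ a (y - y') →
      ‖coordDeriv F i y - coordDeriv F i y'‖ ≤ C * a * (ρ ^ 3)⁻¹ := by
    intro i
    have ha : AnalyticAt ℂ (coordDeriv F i) 0 :=
      analyticOnNhd_coordDeriv (U := {0}) (by rintro x rfl; exact hF) i 0 rfl
    refine exists_weighted_lipschitz ha ?_ (fun j k hj hk => ?_) A hA
    · ext1 v
      rw [map_phase_eq_sum]
      refine Finset.sum_eq_zero fun j _ => ?_
      rw [fderiv_coordDeriv_apply hF]
      have := hord 2 ![j, i] (by
        have h1 := coordWeight_le_two i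
        have h2 := coordWeight_le_two j
        simp [Fin.sum_univ_two]; omega)
      rw [show (![Pi.single j 1, Pi.single i 1] : Fin 2 → Phase) =
        fun l => Pi.single (![j, i] l) 1 by ext l; fin_cases l <;> rfl, this, mul_zero]
    · rw [fderiv_fderiv_coordDeriv_apply hF]
      have := hord 3 ![k, j, i] (by
        have h1 := coordWeight_le_two i
        simp [Fin.sum_univ_three, hj, hk]; omega)
      rw [show (![Pi.single k 1, Pi.single j 1, Pi.single i 1] : Fin 3 → Phase) =
        fun l => Pi.single (![k, j, i] l) 1 by ext l; fin_cases l <;> rfl, this]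
  choose C hC ρ₀ hρ₀ h using key
  refine ⟨∑ i, C i, Finset.sum_nonneg fun i _ => hC i, ∑ i, ρ₀ i, ?_,
    fun ρ hρ y y' hy hy' a ha hd i => ?_⟩
  · exact (hρ₀ 0).trans (Finset.single_le_sum (f := ρ₀)
      (fun j _ => zero_le_one.trans (hρ₀ j)) (Finset.mem_univ 0))
  · have h1 : ρ₀ i ≤ ρ := (Finset.single_le_sum (f := ρ₀)
      (fun j _ => zero_le_one.trans (hρ₀ j)) (Finset.mem_univ i)).trans hρ
    have h2 : 0 ≤ ρ := zero_le_one.trans ((hρ₀ i).trans h1)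
    refine (h i ρ h1 y y' hy hy' a ha hd).trans ?_
    gcongr
    exact Finset.single_le_sum (f := C) (fun j _ => hC j) (Finset.mem_univ i)

theorem analyticOnNhd_hamiltonian (η : ℂ) {F : Phase → ℂ} {U : Set Phase}
    (hF : AnalyticOnNhd ℂ F U) : AnalyticOnNhd ℂ (hamiltonian η F) U := by
  intro x hx
  have hp : ∀ i : Fin 4, AnalyticAt ℂ (fun x : Phase => x i) x := fun i =>
    (ContinuousLinearMap.proj (R := ℂ) (φ := fun _ : Fin 4 => ℂ) i).analyticAt x
  have h0 := hp 0
  have h1 := hp 1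
  have h2 := hp 2
  have h3 := hp 3
  have hFx := hF x hx
  have hI1 := (h1.fun_mul h2).fun_sub (h0.fun_mul h3)
  have hI2 := ((h0.fun_mul h0).fun_add (h1.fun_mul h1)).fun_mul (analyticAt_const (v := (2⁻¹ : ℂ)))
  have hI3 := ((h2.fun_mul h2).fun_add (h3.fun_mul h3)).fun_mul (analyticAt_const (v := (2⁻¹ : ℂ)))
  have hη := (analyticAt_const (v := η) (x := x)).fun_mul (hI3.fun_mul hI3)
  refine (((hI1.fun_neg.fun_add hI2).fun_add hη).fun_add hFx).congr
    (Eventually.of_forall fun y => ?_)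
  simp only [hamiltonian, I₁, I₂, I₃]
  ring

theorem hamVF_hamiltonian (η : ℂ) {F : Phase → ℂ} {x : Phase} (hF : AnalyticAt ℂ F x) :
    hamVF (hamiltonian η F) x =
      ![-x 1 + η * (x 2 * x 2 * x 2 + x 3 * x 3 * x 2) + coordDeriv F 2 x,
        x 0 + η * (x 2 * x 2 * x 3 + x 3 * x 3 * x 3) + coordDeriv F 3 x,
        -x 3 - x 0 - coordDeriv F 0 x,
        x 2 - x 1 - coordDeriv F 1 x] := by
  have hp := fun i : Fin 4 => hasFDerivAt_apply (𝕜 := ℂ) (F' := fun _ : Fin 4 => ℂ) i x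
  have hI1 := ((hp 1).fun_mul (hp 2)).fun_sub ((hp 0).fun_mul (hp 3))
  have hI2 := (((hp 0).fun_mul (hp 0)).fun_add ((hp 1).fun_mul (hp 1))).mul_const (2⁻¹ : ℂ)
  have hI3 := (((hp 2).fun_mul (hp 2)).fun_add ((hp 3).fun_mul (hp 3))).mul_const (2⁻¹ : ℂ)
  have hH := ((hI1.fun_neg.fun_add hI2).fun_add ((hI3.fun_mul hI3).const_mul η)).fun_add
    hF.differentiableAt.hasFDerivAt
  have hD : ∀ i, coordDeriv (hamiltonian η F) i x = _ := fun i => by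
    have e : hamiltonian η F = fun x => -(x 1 * x 2 - x 0 * x 3) + (x 0 * x 0 + x 1 * x 1) * 2⁻¹ +
        η * ((x 2 * x 2 + x 3 * x 3) * 2⁻¹ * ((x 2 * x 2 + x 3 * x 3) * 2⁻¹)) + F x := by
      ext x; simp only [hamiltonian, I₁, I₂, I₃]; ring
    unfold coordDeriv
    rw [e, hH.fderiv]
  ext i
  fin_cases i <;> simp [hamVF, hD] <;> simp only [coordDeriv] <;> ring

/-- The generator of the simultaneous rotation of `(q₁, q₂)` and `(p₁, p₂)`. -/
noncomputable def rotGen : Phase →L[ℂ] Phase :=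
  ContinuousLinearMap.pi ![-ContinuousLinearMap.proj 1, ContinuousLinearMap.proj 0,
    -ContinuousLinearMap.proj 3, ContinuousLinearMap.proj 2]

theorem rotGen_apply (x : Phase) : rotGen x = ![-x 1, x 0, -x 3, x 2] := by
  ext i; fin_cases i <;> rfl

/-- In the tube `|yᵢ| ≤ A ρ^{-wᵢ}`, the field `X` differs from the infinitesimal rotation `ε J` by a
map that gains one power of `ρ`. -/
def IsRotationPerturbation (ε : ℂ) (X : Phase → Phase) : Prop :=
  ∀ A > 0, ∃ C ≥ 0, ∃ ρ₀ ≥ 1, ∀ ρ ≥ ρ₀, ∀ y y', WeightedLE 0 ρ A y → WeightedLE 0 ρ A y' → ∀ a ≥ 0,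
    WeightedLE 0 ρ a (y - y') →
      WeightedLE 1 ρ (C * a) ((X y - ε • rotGen y) - (X y' - ε • rotGen y'))

theorem IsRotationPerturbation.neg {ε : ℂ} {X : Phase → Phase} (hX : IsRotationPerturbation ε X) :
    IsRotationPerturbation (-ε) (-X) := by
  intro A hA
  obtain ⟨C, hC, ρ₀, hρ₀, h⟩ := hX A hA
  refine ⟨C, hC, ρ₀, hρ₀, fun ρ hρ y y' hy hy' a ha hd => ?_⟩
  convert (h ρ hρ y y' hy hy' a ha hd).neg using 1
  simp only [Pi.neg_apply, neg_smul]
  abel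

theorem isRotationPerturbation_hamVF (η : ℂ) {F : Phase → ℂ} (hF : AnalyticAt ℂ F 0)
    (hord : HasWeightedOrderAtLeast 5 F) :
    IsRotationPerturbation 1 (hamVF (hamiltonian η F)) := by
  intro A hA
  obtain ⟨C, hC, ρ₀, hρ₀, h⟩ := exists_weighted_lipschitz_coordDeriv hF hord A hA
  obtain ⟨r, hr, hball⟩ := Metric.eventually_nhds_iff_ball.1 hF.eventually_analyticAt
  have hAr : 0 < A / r := by positivity
  refine ⟨‖η‖ * (6 * A ^ 2) + C + 1, by positivity, ρ₀ + A / r, by linarith,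
    fun ρ hρ y y' hy hy' a ha hd => ?_⟩
  have hρ1 : 1 ≤ ρ := by linarith
  have hρ0 : 0 < ρ := by linarith
  have hsmall : A * ρ⁻¹ < r := by
    rw [← div_eq_mul_inv, div_lt_iff₀ hρ0, mul_comm, ← div_lt_iff₀ hr]; linarith
  have hFy := hball y (by simpa using (hy.norm_le hA.le hρ1).trans_lt hsmall)
  have hFy' := hball y' (by simpa using (hy'.norm_le hA.le hρ1).trans_lt hsmall)
  have hFd := h ρ (by linarith) y y' hy hy' a ha hd
  have hm := fun i j k => norm_mul₃_sub_le hρ1 ha hA.le hy hy' hd i j k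
  have hcub : ∀ k, coordWeight k = 1 → ‖η * ((y 2 * y 2 * y k + y 3 * y 3 * y k) -
      (y' 2 * y' 2 * y' k + y' 3 * y' 3 * y' k))‖ ≤ ‖η‖ * (6 * A ^ 2) * a * (ρ ^ 3)⁻¹ := by
    intro k hk
    have h1 := (norm_add_le _ _).trans (add_le_add (hm 2 2 k rfl rfl hk) (hm 3 3 k rfl rfl hk))
    rw [← add_sub_add_comm] at h1
    rw [norm_mul]
    exact (mul_le_mul_of_nonneg_left h1 (norm_nonneg η)).trans_eq (by ring)
  have hpos : 0 ≤ a * (ρ ^ 3)⁻¹ := by positivity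
  have hq : ∀ j k, coordWeight k = 1 → ‖η * ((y 2 * y 2 * y k + y 3 * y 3 * y k) -
      (y' 2 * y' 2 * y' k + y' 3 * y' 3 * y' k)) + (coordDeriv F j y - coordDeriv F j y')‖ ≤
      (‖η‖ * (6 * A ^ 2) + C + 1) * a * (ρ ^ 3)⁻¹ := by
    intro j k hk
    refine (norm_add_le _ _).trans ((add_le_add (hcub k hk) (hFd j)).trans ?_)
    nlinarith
  have hp : ∀ j, coordWeight j = 2 → ‖-((y - y') j) - (coordDeriv F j y - coordDeriv F j y')‖ ≤
      (‖η‖ * (6 * A ^ 2) + C + 1) * a * (ρ ^ 2)⁻¹ := by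
    intro j hj
    have h1 : ‖(y - y') j‖ ≤ a * (ρ ^ 2)⁻¹ := by
      have := hd j
      rwa [hj] at this
    have h2 : (ρ ^ 3)⁻¹ ≤ (ρ ^ 2)⁻¹ :=
      inv_anti₀ (by positivity) (pow_le_pow_right₀ hρ1 (by norm_num))
    have h3 : C * a * (ρ ^ 3)⁻¹ ≤ C * a * (ρ ^ 2)⁻¹ := by gcongr
    have h4 : 0 ≤ ‖η‖ * (6 * A ^ 2) * (a * (ρ ^ 2)⁻¹) := by positivity
    refine (norm_sub_le _ _).trans ?_
    rw [norm_neg]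
    refine (add_le_add h1 (hFd j)).trans ?_
    nlinarith
  intro i
  rw [hamVF_hamiltonian η hFy, hamVF_hamiltonian η hFy', rotGen_apply, rotGen_apply]
  fin_cases i
  · refine le_trans (le_of_eq ?_) (hq 2 2 rfl)
    congr 1; simp; ring
  · refine le_trans (le_of_eq ?_) (hq 3 3 rfl)
    congr 1; simp; ring
  · refine le_trans (le_of_eq ?_) (hp 0 rfl)
    congr 1; simp; ring
  · refine le_trans (le_of_eq ?_) (hp 1 rfl)
    congr 1; simp; ring

/-! ### The rotating frame -/

/-- The rotation by the complex angle `φ` in the planes of `(q₁, q₂)` and of `(p₁, p₂)`. -/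
noncomputable def rot (φ : ℂ) : Phase →L[ℂ] Phase :=
  Complex.cos φ • ContinuousLinearMap.id ℂ Phase + Complex.sin φ • rotGen

theorem rot_apply (φ : ℂ) (v : Phase) :
    rot φ v = Complex.cos φ • v + Complex.sin φ • rotGen v := rfl

theorem rotGen_rotGen (v : Phase) : rotGen (rotGen v) = -v := by
  rw [rotGen_apply, rotGen_apply]
  ext i; fin_cases i <;> simp

theorem rotGen_rot (φ : ℂ) (v : Phase) : rotGen (rot φ v) = rot φ (rotGen v) := by
  simp [rot_apply]

theorem rot_rot_neg (φ : ℂ) (v : Phase) : rot φ (rot (-φ) v) = v := by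
  have := Complex.sin_sq_add_cos_sq φ
  simp only [rot_apply, Complex.cos_neg, Complex.sin_neg, map_add, map_smul, rotGen_rotGen]
  have e : Complex.cos φ • (Complex.cos φ • v + Complex.sin φ • rotGen v) +
      -Complex.sin φ • (Complex.cos φ • rotGen v + Complex.sin φ • -v) =
      (Complex.sin φ ^ 2 + Complex.cos φ ^ 2) • v := by module
  rw [e, this, one_smul]

theorem differentiable_rot_comp {ε : ℂ} : Differentiable ℂ fun φ : ℂ => rot (ε * φ) := by
  unfold rot; fun_prop

theorem hasDerivAt_rot (φ : ℂ) : HasDerivAt rot (rotGen.comp (rot φ)) φ := by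
  have h := ((Complex.hasDerivAt_cos φ).smul_const (ContinuousLinearMap.id ℂ Phase)).add
    ((Complex.hasDerivAt_sin φ).smul_const rotGen)
  refine h.congr_deriv ?_
  ext1 v
  simp [rot_apply, rotGen_rotGen, add_comm]

namespace WeightedLE

variable {M N : ℕ} {ρ a : ℝ} {v : Phase}

theorem rotGen (hv : WeightedLE M ρ a v) : WeightedLE M ρ a (rotGen v) := by
  intro i
  rw [rotGen_apply]
  fin_cases i
  · exact (norm_neg (v 1)).trans_le (hv 1)
  · exact hv 0
  · exact (norm_neg (v 3)).trans_le (hv 3)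
  · exact hv 2

theorem smul (hv : WeightedLE M ρ a v) (z : ℂ) : WeightedLE M ρ (‖z‖ * a) (z • v) := fun i => by
  rw [Pi.smul_apply, norm_smul, mul_assoc]
  exact mul_le_mul_of_nonneg_left (hv i) (norm_nonneg z)

theorem rot (hv : WeightedLE M ρ a v) (hρ : 0 ≤ ρ) (ha : 0 ≤ a) {φ : ℂ} {y : ℝ}
    (hφ : |φ.im| ≤ y) : WeightedLE M ρ (2 * Real.exp y * a) (rot φ v) := by
  rw [rot_apply]
  refine ((hv.smul _).add (hv.rotGen.smul _)).mono hρ ?_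
  have := mul_le_mul_of_nonneg_right (norm_cos_le hφ) ha
  have := mul_le_mul_of_nonneg_right (norm_sin_le hφ) ha
  linarith

theorem shift_iff : WeightedLE (M + N) ρ a v ↔ WeightedLE N ρ (a * (ρ ^ M)⁻¹) v := by
  refine forall_congr' fun i => ?_
  rw [add_assoc, pow_add, mul_inv, mul_assoc]

theorem of_add (hv : WeightedLE (M + N) ρ a v) (hρ : 1 ≤ ρ) (ha : 0 ≤ a) : WeightedLE N ρ a v := by
  refine (shift_iff.1 hv).mono (by linarith) ?_
  exact mul_le_of_le_one_right ha (inv_le_one_of_one_le₀ (one_le_pow₀ hρ))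

theorem of_norm_le (hv : ‖v‖ ≤ a * (ρ ^ (M + 2))⁻¹) (ha : 0 ≤ a) (hρ : 1 ≤ ρ) :
    WeightedLE M ρ a v := fun i => by
  refine (norm_le_pi_norm v i).trans (hv.trans ?_)
  have := coordWeight_le_two i
  gcongr

end WeightedLE

/-! ### Uniqueness along a characteristic -/

theorem norm_le_of_deriv_le {f f' : ℝ → ℂ} {A κ b : ℝ} {m : ℕ} (hA : 0 < A) (hκ : 0 < κ)
    (hb : 0 ≤ b) (hf : ∀ s, 0 ≤ s → HasDerivAt f (f' s) s)
    (hf' : ∀ s, 0 ≤ s → ‖f' s‖ ≤ b * ((A + κ * s) ^ (m + 2))⁻¹) (hlim : Tendsto f atTop (𝓝 0)) :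
    ‖f 0‖ ≤ b / (κ * (m + 1)) * (A ^ (m + 1))⁻¹ := by
  let B : ℝ → ℝ := fun t => b * -(((κ * (m + 1)) * (A + κ * t) ^ (m + 1))⁻¹) -
    b * -(((κ * (m + 1)) * A ^ (m + 1))⁻¹)
  have hB : ∀ s, 0 ≤ s → HasDerivAt B (b * ((A + κ * s) ^ (m + 2))⁻¹) s := fun s hs =>
    ((hasDerivAt_neg_inv_pow hA hκ m hs).const_mul b).sub_const _
  have key : ∀ S, 0 ≤ S → ‖f S - f 0‖ ≤ b / (κ * (m + 1)) * (A ^ (m + 1))⁻¹ := by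
    intro S hS
    have := image_norm_le_of_norm_deriv_right_le_deriv_boundary' (f := fun s => f s - f 0)
      (f' := f') (a := 0) (b := S) (B := B)
      (fun s hs => ((hf s hs.1).sub_const _).continuousAt.continuousWithinAt)
      (fun s hs => ((hf s hs.1).sub_const _).hasDerivWithinAt) (by simp [B])
      (fun s hs => (hB s hs.1).continuousAt.continuousWithinAt)
      (fun s hs => (hB s hs.1).hasDerivWithinAt) (fun s hs => hf' s hs.1)
      (right_mem_Icc.2 hS)
    refine this.trans ?_
    have h1 : 0 ≤ b * (((κ * (m + 1)) * (A + κ * S) ^ (m + 1))⁻¹) := by positivity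
    have h2 : b / (κ * (m + 1)) * (A ^ (m + 1))⁻¹ = b * (((κ * (m + 1)) * A ^ (m + 1))⁻¹) := by
      rw [mul_inv (κ * (m + 1))]; ring
    simp only [B]
    rw [h2]; linarith
  have h1 : Tendsto (fun S => ‖f S - f 0‖) atTop (𝓝 ‖f 0‖) := by
    have := (hlim.sub_const (f 0)).norm
    simpa using this
  exact le_of_tendsto h1 ((eventually_ge_atTop 0).mono key)

/-- A solution of a linear differential inequality that decays like a high power of the weight
vanishes, since integrating from infinity halves the constant in any such bound. -/
theorem eq_zero_of_weighted_deriv_le {δ δ' : ℝ → Phase} {τ : ℂ} {κ L b : ℝ} {M : ℕ} (hκ : κ ≤ 1)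
    (hκ0 : 0 < κ) (hL0 : 0 ≤ L) (hL : L ≤ κ * (M + 1) / 2) (hτ : κ * ‖τ‖ < rho τ) {T : ℝ}
    (hT : 0 ≤ T) (hδ : ∀ t ≥ T, HasDerivAt δ (δ' t) t)
    (hδ' : ∀ t ≥ T, ∀ b ≥ 0, WeightedLE M (rho (τ - t)) b (δ t) →
      WeightedLE (M + 1) (rho (τ - t)) (L * b) (δ' t))
    (hb0 : 0 ≤ b) (hb : ∀ t ≥ T, WeightedLE M (rho (τ - t)) b (δ t)) : ∀ t ≥ T, δ t = 0 := by
  have hρpos : 0 < rho τ := lt_of_le_of_lt (by positivity) hτ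
  have hτt : ∀ t : ℝ, 0 ≤ t → κ * ‖τ - t‖ < rho (τ - t) := fun t ht =>
    norm_lt_rho_sub hκ hκ0.le hτ ht
  have hgrow : ∀ t ≥ T, ∀ s : ℝ, 0 ≤ s → rho (τ - t) + κ * s ≤ rho (τ - (t + s : ℝ)) := by
    intro t ht s hs
    have := rho_add_le_rho_sub hκ (hτt t (hT.trans ht)).le hs
    rwa [sub_sub, ← Complex.ofReal_add] at this
  have hpos : ∀ t ≥ T, 0 < rho (τ - t) := fun t ht => by
    have := rho_add_le_rho_sub hκ hτ.le (hT.trans ht)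
    have : 0 ≤ κ * t := mul_nonneg hκ0.le (hT.trans ht)
    linarith
  have hhalf : ∀ b ≥ 0, (∀ t ≥ T, WeightedLE M (rho (τ - t)) b (δ t)) →
      ∀ t ≥ T, WeightedLE M (rho (τ - t)) (b / 2) (δ t) := by
    intro b hb hW t ht i
    have hA := hpos t ht
    have hw := coordWeight_pos i
    have hbd : ∀ (e : ℕ) (s : ℝ), 0 ≤ s → (rho (τ - (t + s : ℝ)) ^ e)⁻¹ ≤
        ((rho (τ - t) + κ * s) ^ e)⁻¹ := fun e s hs => by
      have h1 := hgrow t ht s hs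
      have h2 : 0 < rho (τ - t) + κ * s := by positivity
      gcongr
    have := norm_le_of_deriv_le (f := fun s => δ (t + s) i) (f' := fun s => δ' (t + s) i)
      (b := L * b) (m := M + coordWeight i - 1) hA hκ0 (by positivity)
      (fun s hs => ?_) (fun s hs => ?_) ?_
    · rw [add_zero, show M + coordWeight i - 1 + 1 = M + coordWeight i by omega] at this
      refine this.trans (mul_le_mul_of_nonneg_right ?_ (by positivity))
      have hM : (M : ℝ) ≤ ((M + coordWeight i - 1 : ℕ) : ℝ) := by exact_mod_cast by omega
      rw [div_le_iff₀ (by positivity)]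
      have : κ * (M + 1) ≤ κ * (((M + coordWeight i - 1 : ℕ) : ℝ) + 1) := by gcongr
      nlinarith
    · exact (hasDerivAt_pi.1 (hδ (t + s) (by linarith)) i).comp_const_add t s
    · have h1 := weightedLE_succ_iff.1 (hδ' (t + s) (by linarith) b hb (hW _ (by linarith))) i
      exact h1.trans (mul_le_mul_of_nonneg_left (hbd _ s hs) (by positivity))
    · refine squeeze_zero_norm' (a := fun s => b * ((rho (τ - t) + κ * s) ^ (M + coordWeight i))⁻¹)
        ?_ ?_
      · filter_upwards [eventually_ge_atTop 0] with s hs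
        exact (hW (t + s) (by linarith) i).trans (mul_le_mul_of_nonneg_left (hbd _ s hs) hb)
      · rw [← mul_zero b]
        refine (tendsto_inv_atTop_zero.comp ((tendsto_pow_atTop (by omega)).comp ?_)).const_mul b
        exact tendsto_atTop_add_const_left _ _ (tendsto_id.const_mul_atTop hκ0)
  have hpow : ∀ n : ℕ, ∀ t ≥ T, WeightedLE M (rho (τ - t)) (b / 2 ^ n) (δ t) := by
    intro n
    induction n with
    | zero => simpa using hb
    | succ n ih =>
      have := hhalf _ (by positivity) ih
      simpa [pow_succ, div_div] using this
  intro t ht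
  ext i
  rw [Pi.zero_apply, ← norm_le_zero_iff]
  refine ge_of_tendsto' (x := atTop)
    (f := fun n : ℕ => b / 2 ^ n * (rho (τ - t) ^ (M + coordWeight i))⁻¹) ?_ fun n => hpow n t ht i
  rw [← zero_mul (rho (τ - t) ^ (M + coordWeight i))⁻¹]
  refine Tendsto.mul_const _ ?_
  simpa [div_eq_mul_inv] using
    (tendsto_pow_atTop_nhds_zero_of_lt_one (r := (1 / 2 : ℝ)) (by norm_num)
      (by norm_num)).const_mul b

/-- Analytic maps that agree far away on a characteristic agree on all of it. -/
theorem eq_of_eq_far {Γ₁ Γ₂ : ℂ × ℂ → Phase} {Ω : Set (ℂ × ℂ)} (h1 : AnalyticOnNhd ℂ Γ₁ Ω)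
    (h2 : AnalyticOnNhd ℂ Γ₂ Ω) {x : ℂ × ℂ} (hx : ∀ t : ℝ, 0 ≤ t → x - diagPt t ∈ Ω) {T : ℝ}
    (heq : ∀ t ≥ T, Γ₁ (x - diagPt t) = Γ₂ (x - diagPt t)) : Γ₁ x = Γ₂ x := by
  have hlin : ∀ t : ℝ, AnalyticAt ℝ (fun t : ℝ => x - diagPt t) t := fun t => by
    have h : AnalyticAt ℝ (fun t : ℝ => (t : ℂ)) t := Complex.ofRealCLM.analyticAt t
    exact analyticAt_const.sub (h.prod h)
  have ha : ∀ {Γ : ℂ × ℂ → Phase}, AnalyticOnNhd ℂ Γ Ω →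
      AnalyticOnNhd ℝ (fun t : ℝ => Γ (x - diagPt t)) (Ici 0) := fun {Γ} hΓ t ht =>
    AnalyticAt.fun_comp (f := fun t : ℝ => x - diagPt t)
      ((hΓ _ (hx t ht)).restrictScalars (𝕜 := ℝ)) (hlin t)
  have := (ha h1).eqOn_of_preconnected_of_eventuallyEq (ha h2) isPreconnected_Ici
    (z₀ := max T 0 + 1) (by simp; positivity) (by
      filter_upwards [lt_mem_nhds (lt_add_one (max T 0))] with t ht
      exact heq t ((le_max_left _ _).trans ht.le))
  have h0 := this (mem_Ici.2 (le_refl (0 : ℝ)))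
  have e : x - diagPt 0 = x := by ext <;> simp [diagPt]
  simpa only [e] using h0

/-! ### Expansions to finite order -/

/-- `Γ` agrees with the formal series up to an error `O(|τ|^{-N-1})` in `Ω`. -/
def HasExpansionUpTo (N : ℕ) (Ω : Set (ℂ × ℂ)) (Γ : ℂ × ℂ → Phase) (c : ℕ → ℂ → Phase) : Prop :=
  ∃ C > 0, ∃ R > 0, ∀ x ∈ Ω, R < ‖x.2‖ → ‖Γ x - trunc c N x‖ ≤ C * (‖x.2‖ ^ (N + 1))⁻¹

theorem hasAsymptoticExpansion_iff {h : ℝ} {D : Set ℂ} {Γ : ℂ × ℂ → Phase} {c : ℕ → ℂ → Phase} :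
    HasAsymptoticExpansion h D Γ c ↔ ∀ N, HasExpansionUpTo N (strip h ×ˢ D) Γ c := by
  refine forall_congr' fun N => exists_congr fun C => and_congr_right fun _ =>
    exists_congr fun R => and_congr_right fun _ => ?_
  exact ⟨fun H x hx => H x.1 hx.1 x.2 hx.2, fun H φ hφ τ hτ => H (φ, τ) ⟨hφ, hτ⟩⟩

theorem inv_norm_pow_le {τ : ℂ} (hτ : 0 < rho τ) (n : ℕ) :
    (‖τ‖ ^ n)⁻¹ ≤ 2 ^ n * (rho τ ^ n)⁻¹ := by
  have h1 := rho_le_two_mul τ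
  have h2 : 0 < ‖τ‖ := by linarith
  rw [← div_eq_mul_inv, ← div_pow, ← inv_pow]
  gcongr
  rw [inv_eq_one_div, div_le_div_iff₀ h2 hτ]
  linarith

theorem inv_rho_pow_le {τ : ℂ} {κ : ℝ} (hκ : 0 < κ) (hτ0 : 0 < ‖τ‖) (hτ : κ * ‖τ‖ < rho τ) (n : ℕ) :
    (rho τ ^ n)⁻¹ ≤ (κ ^ n)⁻¹ * (‖τ‖ ^ n)⁻¹ := by
  rw [← mul_inv, ← mul_pow]
  have : 0 < κ * ‖τ‖ := by positivity
  gcongr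

namespace IsAdmissibleCoeff

variable {c : ℕ → ℂ → Phase}

theorem norm_trunc_sub_trunc_le (hc : IsAdmissibleCoeff c) (h : ℝ) {N N' : ℕ} (hN : N ≤ N') :
    ∃ C > 0, ∀ x : ℂ × ℂ, x.1 ∈ strip h → 1 < ‖x.2‖ →
      ‖trunc c N' x - trunc c N x‖ ≤ C * (‖x.2‖ ^ (N + 1))⁻¹ := by
  obtain ⟨B, hB0, hB⟩ := hc.bounded_le N' h
  refine ⟨N' * B + 1, by positivity, fun x hx hx2 => ?_⟩
  have e : trunc c N' x - trunc c N x = ∑ k ∈ Finset.Icc (N + 1) N', (x.2 ^ k)⁻¹ • c k x.1 := by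
    rw [sub_eq_iff_eq_add']
    unfold trunc
    have hI : ∀ a b : ℕ, Finset.Icc (a + 1) b = Finset.Ioc a b := fun a b => by
      ext k; simp only [Finset.mem_Icc, Finset.mem_Ioc]; omega
    rw [hI, ← zero_add 1, hI, hI]
    have := Finset.sum_Ioc_consecutive (fun k => (x.2 ^ k)⁻¹ • c k x.1) (Nat.zero_le N) hN
    exact this.symm
  rw [e]
  have h1 : ‖∑ k ∈ Finset.Icc (N + 1) N', (x.2 ^ k)⁻¹ • c k x.1‖ ≤
      ∑ k ∈ Finset.Icc (N + 1) N', (‖x.2‖ ^ (N + 1))⁻¹ * B := by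
    refine norm_sum_le_of_le _ fun k hk => ?_
    obtain ⟨hk1, hk2⟩ := Finset.mem_Icc.1 hk
    rw [norm_smul, norm_inv, norm_pow]
    refine mul_le_mul ?_ (hB k hk2 _ hx) (norm_nonneg _) (by positivity)
    exact inv_anti₀ (by positivity) (pow_le_pow_right₀ hx2.le hk1)
  refine h1.trans ?_
  simp only [Finset.sum_const, Nat.card_Icc, nsmul_eq_mul]
  have h2 : ((N' + 1 - (N + 1) : ℕ) : ℝ) ≤ N' := by exact_mod_cast by omega
  have h3 : 0 ≤ (‖x.2‖ ^ (N + 1))⁻¹ := by positivity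
  calc ((N' + 1 - (N + 1) : ℕ) : ℝ) * ((‖x.2‖ ^ (N + 1))⁻¹ * B)
      ≤ N' * ((‖x.2‖ ^ (N + 1))⁻¹ * B) := by gcongr
    _ ≤ (N' * B + 1) * (‖x.2‖ ^ (N + 1))⁻¹ := by nlinarith

/-- All truncations lie in one weighted tube, provided that `|τ|` is large. -/
theorem exists_weightedLE_trunc (hc : IsAdmissibleCoeff c) (h : ℝ) :
    ∃ A > 0, ∀ N, ∃ R > 0, ∀ x : ℂ × ℂ, x.1 ∈ strip h → R < ‖x.2‖ → 0 < rho x.2 →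
      WeightedLE 0 (rho x.2) A (trunc c N x) := by
  obtain ⟨B₂, hB₂0, hB₂⟩ := hc.bounded_le 2 h
  refine ⟨4 * (B₂ + 1), by positivity, fun N => ?_⟩
  obtain ⟨B, hB0, hB⟩ := hc.bounded_le N h
  refine ⟨N * B + 1, by positivity, fun x hx hR hρ i => ?_⟩
  have hNB : 0 ≤ N * B := by positivity
  have hx1 : 1 < ‖x.2‖ := by linarith
  have hx0 : 0 < ‖x.2‖ := by linarith
  set w := coordWeight i with hw
  have hw2 : w ≤ 2 := coordWeight_le_two i
  have hterm : ∀ k ∈ Finset.Icc 1 N, ‖((x.2 ^ k)⁻¹ • c k x.1) i‖ ≤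
      (if k = w then B₂ * (‖x.2‖ ^ w)⁻¹ else 0) + B * (‖x.2‖ ^ (w + 1))⁻¹ := by
    intro k hk
    obtain ⟨hk1, hk2⟩ := Finset.mem_Icc.1 hk
    rw [Pi.smul_apply, norm_smul, norm_inv, norm_pow]
    have hpos : 0 ≤ B * (‖x.2‖ ^ (w + 1))⁻¹ := by positivity
    rcases lt_trichotomy k w with hlt | heq | hgt
    · rw [hc.form k i hlt, if_neg hlt.ne]; simpa using hpos
    · rw [if_pos heq, heq, mul_comm]
      refine le_add_of_le_of_nonneg ?_ hpos
      gcongr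
      exact (norm_le_pi_norm _ i).trans (hB₂ w hw2 _ hx)
    · rw [if_neg hgt.ne', zero_add, mul_comm]
      refine mul_le_mul ((norm_le_pi_norm _ i).trans (hB k hk2 _ hx)) ?_ (by positivity) hB0
      exact inv_anti₀ (by positivity) (pow_le_pow_right₀ hx1.le hgt)
  have h1 : ‖trunc c N x i‖ ≤ (B₂ + 1) * (‖x.2‖ ^ w)⁻¹ := by
    unfold trunc
    rw [Finset.sum_apply]
    refine (norm_sum_le_of_le _ hterm).trans ?_
    rw [Finset.sum_add_distrib, Finset.sum_ite_eq', add_mul, one_mul]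
    refine add_le_add ?_ ?_
    · split_ifs
      · exact le_rfl
      · positivity
    · simp only [Finset.sum_const, Nat.card_Icc, add_tsub_cancel_right, nsmul_eq_mul]
      have h2 : N * B * ‖x.2‖⁻¹ ≤ 1 := by
        rw [← div_eq_mul_inv, div_le_one hx0]; linarith
      calc (N : ℝ) * (B * (‖x.2‖ ^ (w + 1))⁻¹) = N * B * ‖x.2‖⁻¹ * (‖x.2‖ ^ w)⁻¹ := by
            rw [pow_succ, mul_inv]; ring
        _ ≤ 1 * (‖x.2‖ ^ w)⁻¹ := by gcongr
        _ = (‖x.2‖ ^ w)⁻¹ := one_mul _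
  rw [zero_add]
  refine h1.trans ?_
  have h2 := inv_norm_pow_le hρ w
  have h3 : (2 : ℝ) ^ w ≤ 4 := by
    calc (2 : ℝ) ^ w ≤ 2 ^ 2 := pow_le_pow_right₀ (by norm_num) hw2
      _ = 4 := by norm_num
  calc (B₂ + 1) * (‖x.2‖ ^ w)⁻¹ ≤ (B₂ + 1) * (4 * (rho x.2 ^ w)⁻¹) := by
        gcongr
        exact h2.trans (by gcongr)
    _ = 4 * (B₂ + 1) * (rho x.2 ^ w)⁻¹ := by ring

end IsAdmissibleCoeff

theorem HasExpansionUpTo.of_le {h : ℝ} {c : ℕ → ℂ → Phase} (hc : IsAdmissibleCoeff c) {N N' : ℕ}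
    (hN : N ≤ N') {Ω : Set (ℂ × ℂ)} (hΩ : ∀ x ∈ Ω, x.1 ∈ strip h) {Γ : ℂ × ℂ → Phase}
    (hΓ : ∃ C > 0, ∃ R > 0, ∀ x ∈ Ω, R < ‖x.2‖ → ‖Γ x - trunc c N' x‖ ≤ C * (‖x.2‖ ^ (N + 1))⁻¹) :
    HasExpansionUpTo N Ω Γ c := by
  obtain ⟨C, hC, R, hR, H⟩ := hΓ
  obtain ⟨C', hC', H'⟩ := hc.norm_trunc_sub_trunc_le h hN
  refine ⟨C + C', by positivity, R + 1, by positivity, fun x hx hxR => ?_⟩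
  have h1 := H x hx (by linarith)
  have h2 := H' x (hΩ x hx) (by linarith)
  calc ‖Γ x - trunc c N x‖ = ‖(Γ x - trunc c N' x) + (trunc c N' x - trunc c N x)‖ := by
        congr 1; abel
    _ ≤ _ := norm_add_le _ _
    _ ≤ _ := (add_le_add h1 h2).trans_eq (by ring)

theorem HasExpansionUpTo.mono {h : ℝ} {c : ℕ → ℂ → Phase} (hc : IsAdmissibleCoeff c) {N N' : ℕ}
    (hN : N ≤ N') {Ω : Set (ℂ × ℂ)} (hΩ : ∀ x ∈ Ω, x.1 ∈ strip h) {Γ : ℂ × ℂ → Phase}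
    (hΓ : HasExpansionUpTo N' Ω Γ c) : HasExpansionUpTo N Ω Γ c := by
  refine HasExpansionUpTo.of_le hc hN hΩ ?_
  obtain ⟨C, hC, R, hR, H⟩ := hΓ
  refine ⟨C, hC, R + 1, by positivity, fun x hx hxR => (H x hx (by linarith)).trans ?_⟩
  have h1 : 1 ≤ ‖x.2‖ := by linarith
  gcongr

/-! ### Uniqueness and existence near `τ = ∞` -/

theorem abs_im_ofReal_mul_le {ε h : ℝ} {φ : ℂ} (hφ : φ ∈ strip h) :
    |((ε : ℂ) * φ).im| ≤ |ε| * h := by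
  have h1 : |φ.im| < h := hφ
  rw [Complex.im_ofReal_mul, abs_mul]
  exact mul_le_mul_of_nonneg_left h1.le (abs_nonneg ε)

/-- A gain of one power of the weight survives the passage to the rotating frame. -/
theorem IsRotationPerturbation.weightedLE_rot {X : Phase → Phase} {ε h A C ρ₀ : ℝ} (hC : 0 ≤ C)
    (H : ∀ ρ ≥ ρ₀, ∀ y y', WeightedLE 0 ρ A y → WeightedLE 0 ρ A y' → ∀ a ≥ 0,
      WeightedLE 0 ρ a (y - y') → WeightedLE 1 ρ (C * a)
        ((X y - (ε : ℂ) • rotGen y) - (X y' - (ε : ℂ) • rotGen y')))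
    {ρ : ℝ} (hρ : ρ₀ ≤ ρ) (hρ1 : 1 ≤ ρ) {y y' v : Phase} (hy : WeightedLE 0 ρ A y)
    (hy' : WeightedLE 0 ρ A y') {φ : ℂ} (hφ : φ ∈ strip h) (e : y - y' = rot (ε * φ) v) {a : ℝ}
    (ha : 0 ≤ a) {M : ℕ} (hv : WeightedLE M ρ a v) :
    WeightedLE (M + 1) ρ
      ((2 * Real.exp (|ε| * h)) * (C * (2 * Real.exp (|ε| * h))) * a)
      (rot (-(ε * φ)) ((X y - (ε : ℂ) • rotGen y) - (X y' - (ε : ℂ) • rotGen y'))) := by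
  have hρ0 : 0 ≤ ρ := by linarith
  have him := abs_im_ofReal_mul_le (ε := ε) hφ
  have h1 := hv.rot hρ0 ha him
  rw [← e] at h1
  have h2 := H ρ hρ y y' hy hy' _ (by positivity) (WeightedLE.shift_iff (N := 0).1 h1)
  rw [← mul_assoc] at h2
  have h3 := WeightedLE.shift_iff.2 h2
  have h4 := h3.rot (φ := -(ε * φ)) (y := |ε| * h) hρ0 (by positivity) (by simpa using him)
  convert h4 using 1
  ring

/-- Two solutions with the same expansion up to a sufficiently high order coincide. -/
theorem exists_eqOn_of_hasExpansionUpTo {X : Phase → Phase} {c : ℕ → ℂ → Phase}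
    (hc : IsAdmissibleCoeff c) {ε : ℝ} (hX : IsRotationPerturbation ε X) {h κ : ℝ} (hκ0 : 0 < κ)
    (hκ : κ ≤ 1) : ∃ N₀, ∀ N ≥ N₀, ∀ (Ω : Set (ℂ × ℂ)) (Γ₁ Γ₂ : ℂ × ℂ → Phase),
      (∀ x ∈ Ω, x.1 ∈ strip h ∧ κ * ‖x.2‖ < rho x.2) →
      (∀ x ∈ Ω, ∀ t : ℝ, 0 ≤ t → x - diagPt t ∈ Ω) →
      AnalyticOnNhd ℂ Γ₁ Ω → AnalyticOnNhd ℂ Γ₂ Ω →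
      (∀ x ∈ Ω, fderiv ℂ Γ₁ x (1, 1) = X (Γ₁ x)) → (∀ x ∈ Ω, fderiv ℂ Γ₂ x (1, 1) = X (Γ₂ x)) →
      HasExpansionUpTo N Ω Γ₁ c → HasExpansionUpTo N Ω Γ₂ c → EqOn Γ₁ Γ₂ Ω := by
  obtain ⟨A, hA, hAtr⟩ := hc.exists_weightedLE_trunc h
  obtain ⟨C, hC, ρ₀, hρ₀, H⟩ := hX (A + 1) (by positivity)
  set E : ℝ := 2 * Real.exp (|ε| * h) with hE
  have hE0 : 0 < E := by positivity
  set L : ℝ := E * (C * E) with hLdef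
  obtain ⟨M₀, hM₀⟩ := exists_nat_ge (2 * L / κ)
  refine ⟨M₀ + 2, fun N hN Ω Γ₁ Γ₂ hΩ hleft ha₁ ha₂ hs₁ hs₂ he₁ he₂ x hx => ?_⟩
  obtain ⟨M, rfl⟩ : ∃ M, N = M + 2 := ⟨N - 2, by omega⟩
  have hL : L ≤ κ * (M + 1) / 2 := by
    have h1 : (M₀ : ℝ) ≤ M := by exact_mod_cast by omega
    rw [div_le_iff₀ hκ0] at hM₀
    nlinarith
  obtain ⟨R, hR, htr⟩ := hAtr (M + 2)
  -- the closeness to the truncation, in terms of the weight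
  have hclose : ∀ {Γ : ℂ × ℂ → Phase}, HasExpansionUpTo (M + 2) Ω Γ c →
      ∃ a > 0, ∃ P ≥ 1, ∀ y ∈ Ω, P < rho y.2 →
        WeightedLE (M + 1) (rho y.2) a (Γ y - trunc c (M + 2) y) := by
    rintro Γ ⟨C', hC', R', hR', H'⟩
    refine ⟨C' * 2 ^ (M + 3), by positivity, 2 * R' + 1, by linarith, fun y hy hP => ?_⟩
    have h1 := rho_le_two_mul y.2
    have h2 := H' y hy (by linarith)
    refine WeightedLE.of_norm_le (h2.trans ?_) (by positivity) (by linarith)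
    rw [mul_assoc]
    gcongr
    exact inv_norm_pow_le (by linarith) _
  obtain ⟨a₁, ha₁0, P₁, hP₁, hc₁⟩ := hclose he₁
  obtain ⟨a₂, ha₂0, P₂, hP₂, hc₂⟩ := hclose he₂
  let P : ℝ := P₁ + P₂ + ρ₀ + 2 * R + a₁ + a₂
  have htube : ∀ {Γ : ℂ × ℂ → Phase} {a : ℝ} {y : ℂ × ℂ}, y ∈ Ω → 0 < a → a ≤ P → P < rho y.2 →
      WeightedLE (M + 1) (rho y.2) a (Γ y - trunc c (M + 2) y) →
      WeightedLE 0 (rho y.2) (A + 1) (Γ y) := by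
    intro Γ a y hy ha haP hP hW
    have hPρ : 1 ≤ rho y.2 := by simp only [P] at hP; linarith
    have h1 := rho_le_two_mul y.2
    have h2 := htr y (hΩ y hy).1 (by simp only [P] at hP; linarith) (by linarith)
    have h3 : WeightedLE 0 (rho y.2) 1 (Γ y - trunc c (M + 2) y) := by
      refine (WeightedLE.shift_iff (N := 0).1 hW).mono (by linarith) ?_
      rw [← div_eq_mul_inv, div_le_one (by positivity)]
      exact (haP.trans hP.le).trans (le_self_pow₀ hPρ (by omega))
    simpa using h2.add h3
  obtain ⟨hxs, hxκ⟩ := hΩ x hx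
  have hP0 : 0 < P := by simp only [P]; linarith
  have hρx : 0 ≤ rho x.2 := le_trans (by positivity) hxκ.le
  have hfar : ∀ t ≥ P / κ + 1, P < rho (x - diagPt t).2 := by
    intro t ht
    have h0 : 0 ≤ t := le_trans (by positivity) ht
    have h1 := rho_add_le_rho_sub hκ hxκ.le h0
    have h2 : P < κ * t := by
      rw [← div_lt_iff₀' hκ0]; linarith
    exact lt_of_lt_of_le (by linarith) h1
  have hT : 0 ≤ P / κ + 1 := by positivity
  refine eq_of_eq_far ha₁ ha₂ (hleft x hx) (T := P / κ + 1) fun t ht => ?_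
  let φ : ℝ → ℂ := fun t => x.1 - t
  let Δ : ℝ → Phase := fun t => Γ₁ (x - diagPt t) - Γ₂ (x - diagPt t)
  let Y : Phase → Phase := fun y => X y - (ε : ℂ) • rotGen y
  have hzero := eq_zero_of_weighted_deriv_le (δ := fun t => rot (-(ε * φ t)) (Δ t))
    (δ' := fun t => -rot (-(ε * φ t)) (Y (Γ₁ (x - diagPt t)) - Y (Γ₂ (x - diagPt t))))
    (b := E * (a₁ + a₂)) hκ hκ0 (by positivity) hL hxκ hT ?_ ?_ (by positivity) ?_ t ht
  · have h1 := congrArg (rot (ε * φ t)) hzero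
    rw [rot_rot_neg, map_zero] at h1
    exact sub_eq_zero.1 h1
  · intro t ht
    have ht0 : 0 ≤ t := hT.trans ht
    have hy := hleft x hx t ht0
    have e : ∀ s : ℝ, x - diagPt s = x + (-(s : ℂ)) • ((1 : ℂ), (1 : ℂ)) := fun s => by
      ext <;> simp [diagPt, sub_eq_add_neg]
    have hΓ : ∀ {Γ : ℂ × ℂ → Phase}, AnalyticOnNhd ℂ Γ Ω →
        (∀ x ∈ Ω, fderiv ℂ Γ x (1, 1) = X (Γ x)) →
        HasDerivAt (fun s : ℂ => Γ (x + (-s) • ((1 : ℂ), (1 : ℂ))))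
          (-X (Γ (x - diagPt t))) (t : ℂ) := by
      intro Γ hΓa hΓs
      have h1 := hΓs _ hy
      rw [← h1, e t]
      have h2 := hasDerivAt_comp_line (f := Γ) (x := x) (z := -(t : ℂ))
        (by rw [← e t]; exact (hΓa _ hy).differentiableAt)
      have h3 := HasDerivAt.scomp (t : ℂ) (h := fun s : ℂ => -s) h2 (hasDerivAt_neg (t : ℂ))
      simpa [Function.comp_def] using h3
    have hθ : HasDerivAt (fun s : ℂ => -((ε : ℂ) * (x.1 - s))) (ε : ℂ) (t : ℂ) := by
      simpa using (((hasDerivAt_id (t : ℂ)).const_sub x.1).const_mul (ε : ℂ)).fun_neg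
    have hr := HasDerivAt.scomp (t : ℂ) (h := fun s : ℂ => -((ε : ℂ) * (x.1 - s)))
      (hasDerivAt_rot _) hθ
    have h1 := HasDerivAt.scomp t (hr.clm_apply ((hΓ ha₁ hs₁).fun_sub (hΓ ha₂ hs₂)))
      (Complex.ofRealCLM.hasDerivAt (x := t))
    refine (h1.congr_deriv ?_).congr_of_eventuallyEq (Eventually.of_forall fun s => ?_)
    · simp only [Function.comp_apply, Y, φ, ← e, map_sub, map_neg, map_smul,
        smul_apply, ContinuousLinearMap.comp_apply, rotGen_rot,
        Complex.ofRealCLM_apply, Complex.ofReal_one, one_smul]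
      abel
    · simp only [Δ, e, Function.comp_apply, φ]
  · intro t ht b hb hW
    have ht0 : 0 ≤ t := hT.trans ht
    have hy := hleft x hx t ht0
    have hP := hfar t ht
    have hP' : P₁ + P₂ + ρ₀ + 2 * R + a₁ + a₂ < rho (x - diagPt t).2 := hP
    have h1 := IsRotationPerturbation.weightedLE_rot hC H (ρ := rho (x - diagPt t).2)
      (by linarith) (by linarith)
      (htube hy ha₁0 (by simp only [P]; linarith) hP (hc₁ _ hy (by linarith)))
      (htube hy ha₂0 (by simp only [P]; linarith) hP (hc₂ _ hy (by linarith)))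
      (hΩ _ hy).1 (v := rot (-(ε * φ t)) (Δ t)) (rot_rot_neg _ _).symm hb hW
    exact h1.neg
  · intro t ht
    have ht0 : 0 ≤ t := hT.trans ht
    have hy := hleft x hx t ht0
    have hP : P₁ + P₂ + ρ₀ + 2 * R + a₁ + a₂ < rho (x - diagPt t).2 := hfar t ht
    have h1 := (hc₁ _ hy (by linarith)).sub (hc₂ _ hy (by linarith))
    rw [sub_sub_sub_cancel_right] at h1
    have h2 : WeightedLE M (rho (x - diagPt t).2) (a₁ + a₂) (Δ t) := by
      rw [add_comm M 1] at h1
      exact h1.of_add (by linarith) (by positivity)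
    exact h2.rot (by linarith) (by positivity)
      (by rw [Complex.neg_im, abs_neg]; exact abs_im_ofReal_mul_le (φ := φ t) (hΩ _ hy).1)

/-- Existence of solutions with an expansion of any sufficiently high finite order. In the frame
that rotates with angle `ε φ`, the deviation of the solution from a truncation of the series solves
an equation to which the weighted contraction principle applies: its Lipschitz constant does not
depend on the order of the truncation. -/
theorem exists_solution_far {X : Phase → Phase} {U : Set Phase} (hU : IsOpen U) (hU0 : 0 ∈ U)
    (hXa : AnalyticOnNhd ℂ X U) {ε : ℝ} (hX : IsRotationPerturbation ε X) {c : ℕ → ℂ → Phase}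
    (hc : IsAdmissibleCoeff c) {h : ℝ} (hres : IsAsymptoticSolution h X c) {κ : ℝ} (hκ0 : 0 < κ)
    (hκ : κ ≤ 1) : ∃ N₀, ∀ N ≥ N₀, ∃ R ≥ 1, ∃ Γ, AnalyticOnNhd ℂ Γ (domain h κ R) ∧
      MapsTo Γ (domain h κ R) U ∧ (∀ x ∈ domain h κ R, fderiv ℂ Γ x (1, 1) = X (Γ x)) ∧
      HasExpansionUpTo N (domain h κ R) Γ c := by
  obtain ⟨A, hA, hAtr⟩ := hc.exists_weightedLE_trunc h
  set E : ℝ := 2 * Real.exp (|ε| * h) with hE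
  have hE0 : 0 < E := by positivity
  obtain ⟨C, hC, ρ₀, hρ₀, H⟩ := hX (A + E) (by positivity)
  set L : ℝ := E * (C * E) + 1 with hLdef
  have hL0 : 0 ≤ L := by positivity
  obtain ⟨M₀, hM₀⟩ := exists_nat_ge (2 * L / κ)
  refine ⟨M₀, fun M hM => ?_⟩
  have hL : L ≤ κ * (M + 1) / 2 := by
    have h1 : (M₀ : ℝ) ≤ M := by exact_mod_cast hM
    rw [div_le_iff₀ hκ0] at hM₀
    nlinarith
  obtain ⟨Rt, hRt, htr⟩ := hAtr (M + 3)
  obtain ⟨Cr, hCr, Rr, hRr, hres'⟩ := hres (M + 3)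
  obtain ⟨r₀, hr₀, hball⟩ := Metric.isOpen_iff.1 hU 0 hU0
  set S : ℝ := E * (Cr * 2 ^ (M + 4)) with hS
  set R : ℝ := 1 + ρ₀ + 2 * Rt + 2 * Rr + S + (A + E) / r₀ with hRdef
  have hS0 : 0 < S := by positivity
  have hAE : 0 < (A + E) / r₀ := by positivity
  have hR1 : 1 ≤ R := by linarith
  set Ω := domain h κ R with hΩdef
  have hΩo : IsOpen Ω := isOpen_domain h κ R
  let D : ℂ × ℂ → Phase := fun x => fderiv ℂ (trunc c (M + 3)) x (1, 1)
  let Y : ℂ × ℂ → Phase → Phase := fun x v => trunc c (M + 3) x + rot (ε * x.1) v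
  have hx2 : ∀ x ∈ Ω, R < 2 * ‖x.2‖ := fun x hx => hx.2.2.trans_le (rho_le_two_mul x.2)
  have hx0 : ∀ x ∈ Ω, x.2 ≠ 0 := fun x hx => by
    have := hx2 x hx
    exact norm_pos_iff.1 (by linarith)
  have him : ∀ x ∈ Ω, |((ε : ℂ) * x.1).im| ≤ |ε| * h := fun x hx => abs_im_ofReal_mul_le hx.1
  have htube : ∀ x ∈ Ω, ∀ v, WeightedLE M (rho x.2) 1 v →
      WeightedLE 0 (rho x.2) (A + E) (Y x v) := by
    intro x hx v hv
    have h0 : R < rho x.2 := hx.2.2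
    have h1 := hx2 x hx
    have h2 := htr x hx.1 (by linarith) (by linarith)
    have h3 : WeightedLE 0 (rho x.2) 1 v := WeightedLE.of_add (M := M) hv (by linarith) zero_le_one
    have h4 := h3.rot (by linarith) zero_le_one (him x hx)
    rw [mul_one] at h4
    exact h2.add h4
  have hYU : ∀ x ∈ Ω, ∀ v, WeightedLE M (rho x.2) 1 v → Y x v ∈ U := by
    intro x hx v hv
    have h0 : R < rho x.2 := hx.2.2
    have h1 := (htube x hx v hv).norm_le (by positivity) (by linarith)
    refine hball (mem_ball_zero_iff.2 (h1.trans_lt ?_))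
    rw [← div_eq_mul_inv, div_lt_iff₀ (by linarith), mul_comm, ← div_lt_iff₀ hr₀]
    linarith
  let Ψ : ℂ × ℂ → Phase → Phase := fun x v =>
    rot (-(ε * x.1)) (X (Y x v) - (ε : ℂ) • rotGen (rot (ε * x.1) v) - D x)
  have hrot : Differentiable ℂ fun x : ℂ × ℂ => rot (ε * x.1) :=
    (differentiable_rot_comp (ε := (ε : ℂ))).comp differentiable_fst
  have hrot' : Differentiable ℂ fun x : ℂ × ℂ => rot (-(ε * x.1)) := by
    simpa [Function.comp_def] using
      (differentiable_rot_comp (ε := -(ε : ℂ))).comp (differentiable_fst (E := ℂ) (F := ℂ))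
  have hYd : ∀ v : ℂ × ℂ → Phase, DifferentiableOn ℂ v Ω →
      DifferentiableOn ℂ (fun x => Y x (v x)) Ω := by
    intro v hv x hx
    refine DifferentiableWithinAt.fun_add ?_ ?_
    · exact (hc.analyticAt_trunc _ (hx0 x hx)).differentiableAt.differentiableWithinAt
    · exact (hrot x).differentiableWithinAt.clm_apply (hv x hx)
  have hdiff : ∀ v : ℂ × ℂ → Phase, DifferentiableOn ℂ v Ω →
      (∀ x ∈ Ω, WeightedLE M (rho x.2) 1 (v x)) →
      DifferentiableOn ℂ (fun x => Ψ x (v x)) Ω := by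
    intro v hv hvW
    have hX' : DifferentiableOn ℂ (fun x => X (Y x (v x))) Ω :=
      hXa.differentiableOn.comp (hYd v hv) fun x hx => hYU x hx _ (hvW x hx)
    have hrv : DifferentiableOn ℂ (fun x => rotGen (rot (ε * x.1) (v x))) Ω :=
      rotGen.differentiable.comp_differentiableOn (hrot.differentiableOn.clm_apply hv)
    have hD : DifferentiableOn ℂ D Ω := fun x hx =>
      ((hc.analyticAt_trunc _ (hx0 x hx)).fderiv.differentiableAt.clm_apply
        (differentiableAt_const _)).differentiableWithinAt
    exact hrot'.differentiableOn.clm_apply ((hX'.fun_sub (hrv.fun_const_smul (ε : ℂ))).fun_sub hD)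
  have hlip : ∀ x ∈ Ω, ∀ v v', WeightedLE M (rho x.2) 1 v → WeightedLE M (rho x.2) 1 v' →
      ∀ a ≥ 0, WeightedLE M (rho x.2) a (v - v') →
        WeightedLE (M + 1) (rho x.2) (L * a) (Ψ x v - Ψ x v') := by
    intro x hx v v' hv hv' a ha hd
    have h0 : R < rho x.2 := hx.2.2
    have h1 := IsRotationPerturbation.weightedLE_rot hC H (ρ := rho x.2) (by linarith) (by linarith)
      (htube x hx v hv) (htube x hx v' hv') hx.1 (v := v - v') (by simp [Y]) ha hd
    have e : Ψ x v - Ψ x v' = rot (-(ε * x.1)) ((X (Y x v) - (ε : ℂ) • rotGen (Y x v)) -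
        (X (Y x v') - (ε : ℂ) • rotGen (Y x v'))) := by
      simp only [Ψ, Y, ← map_sub]
      congr 1
      simp only [map_add, smul_add]
      abel
    rw [e]
    refine h1.mono (by linarith) ?_
    gcongr
    linarith
  have hzero : ∀ x ∈ Ω, WeightedLE (M + 1) (rho x.2) L (Ψ x 0) := by
    intro x hx
    have h0 : R < rho x.2 := hx.2.2
    have h1 := hx2 x hx
    have h2 := hres' x hx.1 (by linarith)
    have hρ1 : 1 ≤ rho x.2 := by linarith
    have h3 : WeightedLE (1 + (M + 1)) (rho x.2) (Cr * 2 ^ (M + 4))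
        (D x - X (trunc c (M + 3) x)) := by
      refine WeightedLE.of_norm_le (h2.trans ?_) (by positivity) hρ1
      rw [mul_assoc, show 1 + (M + 1) + 2 = M + 4 by ring]
      exact mul_le_mul_of_nonneg_left (inv_norm_pow_le (by linarith) _) hCr.le
    have h4 := (h3.neg.rot (φ := -(ε * x.1)) (y := |ε| * h) (by linarith) (by positivity)
      (by simpa using him x hx))
    have e : Ψ x 0 = rot (-(ε * x.1)) (-(D x - X (trunc c (M + 3) x))) := by
      simp [Ψ, Y]
    rw [e]
    refine (WeightedLE.shift_iff.1 h4).mono (by linarith) ?_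
    have h5 : S * (rho x.2 ^ 1)⁻¹ ≤ 1 := by
      rw [← div_eq_mul_inv, pow_one, div_le_one (by linarith)]
      linarith
    exact h5.trans (le_add_of_nonneg_left (by positivity))
  obtain ⟨v, hva, hvW, hvs⟩ := exists_weighted_solution hκ hκ0 hR1 hL0 hL Ψ hdiff hlip hzero
  refine ⟨R, hR1, fun x => Y x (v x), ?_, fun x hx => hYU x hx _ (hvW x hx), ?_, ?_⟩
  · intro x hx
    have h1 : AnalyticAt ℂ (fun x : ℂ × ℂ => rot (ε * x.1) (v x)) x := by
      have e : (fun x : ℂ × ℂ => rot (ε * x.1) (v x)) = fun x =>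
          Complex.cos (ε * x.1) • v x + Complex.sin (ε * x.1) • rotGen (v x) := rfl
      rw [e]
      have hl : AnalyticAt ℂ (fun x : ℂ × ℂ => (ε : ℂ) * x.1) x :=
        analyticAt_const.fun_mul analyticAt_fst
      exact ((AnalyticAt.fun_comp (Complex.differentiable_cos.analyticAt _) hl).fun_smul
        (hva x hx)).fun_add ((AnalyticAt.fun_comp (Complex.differentiable_sin.analyticAt _)
          hl).fun_smul (AnalyticAt.fun_comp (rotGen.analyticAt (v x)) (hva x hx)))
    exact (hc.analyticAt_trunc _ (hx0 x hx)).fun_add h1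
  · intro x hx
    have e0 : x + (0 : ℂ) • ((1 : ℂ), (1 : ℂ)) = x := by simp
    have hYx : DifferentiableAt ℂ (fun x => Y x (v x)) x :=
      (hYd v hva.differentiableOn x hx).differentiableAt (hΩo.mem_nhds hx)
    have d1 := hasDerivAt_comp_line (f := fun x => Y x (v x)) (x := x) (z := 0) (by rwa [e0])
    have d2 := hasDerivAt_comp_line (f := trunc c (M + 3)) (x := x) (z := 0)
      (by rw [e0]; exact (hc.analyticAt_trunc _ (hx0 x hx)).differentiableAt)
    have d3 := hasDerivAt_comp_line (f := v) (x := x) (z := 0)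
      (by rw [e0]; exact (hva x hx).differentiableAt)
    have d4 : HasDerivAt (fun s : ℂ => (ε : ℂ) * (x.1 + s)) ε 0 := by
      simpa using ((hasDerivAt_id (0 : ℂ)).const_add x.1).const_mul (ε : ℂ)
    have d5 := HasDerivAt.scomp (0 : ℂ) (h := fun s : ℂ => (ε : ℂ) * (x.1 + s))
      (hasDerivAt_rot _) d4
    have d6 := d2.fun_add (d5.clm_apply d3)
    have d7 := d1.unique (d6.congr_of_eventuallyEq (Eventually.of_forall fun s => by
      simp [Y, Function.comp_apply]))
    simp only [e0] at d7
    rw [d7, hvs x hx]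
    simp only [Ψ, D, Function.comp_apply, add_zero, smul_apply, rot_rot_neg,
      ContinuousLinearMap.comp_apply]
    abel
  · refine HasExpansionUpTo.of_le hc (N' := M + 3) (by omega) (fun x hx => hx.1)
      ⟨E * (κ ^ (M + 1))⁻¹, by positivity, 1, one_pos, fun x hx _ => ?_⟩
    have h0 : R < rho x.2 := hx.2.2
    have h1 := (hvW x hx).rot (by linarith) zero_le_one (him x hx)
    rw [mul_one] at h1
    have h2 : ‖rot (ε * x.1) (v x)‖ ≤ E * (rho x.2 ^ (M + 1))⁻¹ := by
      have h3 : 1 ≤ rho x.2 := by linarith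
      refine (pi_norm_le_iff_of_nonneg (by positivity)).2 fun i => (h1 i).trans ?_
      have := coordWeight_pos i
      gcongr
    simp only [Y, add_sub_cancel_left]
    refine h2.trans ?_
    rw [mul_assoc E]
    exact mul_le_mul_of_nonneg_left
      (inv_rho_pow_le hκ0 (norm_pos_iff.2 (hx0 x hx)) hx.2.1 _) hE0.le

theorem HasExpansionUpTo.subset {N : ℕ} {Ω Ω' : Set (ℂ × ℂ)} {Γ : ℂ × ℂ → Phase}
    {c : ℕ → ℂ → Phase} (hΓ : HasExpansionUpTo N Ω Γ c) (hΩ : Ω' ⊆ Ω) :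
    HasExpansionUpTo N Ω' Γ c := by
  obtain ⟨C, hC, R, hR, H⟩ := hΓ
  exact ⟨C, hC, R, hR, fun x hx => H x (hΩ hx)⟩

theorem domain_subset {h κ R R' : ℝ} (hR : R ≤ R') : domain h κ R' ⊆ domain h κ R :=
  fun _ hx => ⟨hx.1, hx.2.1, hR.trans_lt hx.2.2⟩

/-- The solutions obtained for the various orders of truncation coincide for large `τ`, hence each
of them has the full asymptotic expansion. -/
theorem exists_solution_all_orders {X : Phase → Phase} {U : Set Phase} (hU : IsOpen U)
    (hU0 : 0 ∈ U) (hXa : AnalyticOnNhd ℂ X U) {ε : ℝ} (hX : IsRotationPerturbation ε X)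
    {c : ℕ → ℂ → Phase} (hc : IsAdmissibleCoeff c) {h : ℝ} (hres : IsAsymptoticSolution h X c)
    {κ : ℝ} (hκ0 : 0 < κ) (hκ : κ ≤ 1) :
    ∃ R ≥ 1, ∃ Γ, AnalyticOnNhd ℂ Γ (domain h κ R) ∧ MapsTo Γ (domain h κ R) U ∧
      (∀ x ∈ domain h κ R, fderiv ℂ Γ x (1, 1) = X (Γ x)) ∧
      ∀ N, HasExpansionUpTo N (domain h κ R) Γ c := by
  obtain ⟨N₁, hN₁⟩ := exists_solution_far hU hU0 hXa hX hc hres hκ0 hκ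
  obtain ⟨N₂, hN₂⟩ := exists_eqOn_of_hasExpansionUpTo hc hX (h := h) hκ0 hκ
  obtain ⟨R, hR, Γ, hΓa, hΓU, hΓs, hΓe⟩ := hN₁ (max N₁ N₂) (le_max_left _ _)
  refine ⟨R, hR, Γ, hΓa, hΓU, hΓs, fun N => ?_⟩
  obtain ⟨R', hR', Γ', hΓa', -, hΓs', hΓe'⟩ :=
    hN₁ (max N (max N₁ N₂)) ((le_max_left _ _).trans (le_max_right _ _))
  have hs := fun x hx => domain_subset (h := h) (κ := κ) (le_max_left R R') (a := x) hx
  have hs' := fun x hx => domain_subset (h := h) (κ := κ) (le_max_right R R') (a := x) hx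
  have heq : EqOn Γ Γ' (domain h κ (max R R')) :=
    hN₂ (max N₁ N₂) (le_max_right _ _) _ _ _ (fun x hx => ⟨hx.1, hx.2.1⟩)
      (fun x hx t ht => sub_diag_mem_domain hκ hκ0.le hx ht) (hΓa.mono hs) (hΓa'.mono hs')
      (fun x hx => hΓs x (hs x hx)) (fun x hx => hΓs' x (hs' x hx)) (hΓe.subset hs)
      ((hΓe'.mono hc (le_max_right _ _) fun x hx => hx.1).subset hs')
  obtain ⟨C, hC, P, hP, H⟩ := hΓe'.mono hc (le_max_left _ _) fun x hx => hx.1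
  refine ⟨C, hC, P + max R R' / κ, ?_, fun x hx hxP => ?_⟩
  · have : 0 < max R R' := by positivity
    positivity
  · have h1 : 0 ≤ max R R' / κ := by positivity
    have hx' : x ∈ domain h κ (max R R') := by
      refine ⟨hx.1, hx.2.1, lt_trans ?_ hx.2.1⟩
      rw [← div_lt_iff₀' hκ0]
      linarith
    rw [heq hx']
    exact H x (hs' x hx') (by linarith)

/-! ### The sectors -/

theorem mem_sectorMinus_iff {θ r : ℝ} (hθ : 0 ≤ θ) (hθ' : θ ≤ Real.pi) {τ : ℂ} :
    τ ∈ sectorMinus θ r ↔ (1 - Real.cos θ) * ‖τ + r‖ < rho (τ + r) := by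
  change θ < |Complex.arg (τ + r)| ↔ _
  rcases eq_or_ne (τ + r) 0 with h0 | h0
  · simpa [h0, rho] using hθ
  · rw [← Real.strictAntiOn_cos.lt_iff_gt (⟨abs_nonneg _, Complex.abs_arg_le_pi _⟩) ⟨hθ, hθ'⟩,
      Real.cos_abs, Complex.cos_arg h0, div_lt_iff₀ (norm_pos_iff.2 h0), rho]
    constructor <;> intro h <;> linarith

theorem sub_mem_sectorMinus {θ r : ℝ} (hθ : 0 ≤ θ) (hθ' : θ ≤ Real.pi / 2) {τ : ℂ}
    (hτ : τ ∈ sectorMinus θ r) {t : ℝ} (ht : 0 ≤ t) : τ - t ∈ sectorMinus θ r := by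
  have hπ := Real.pi_pos
  have hcos := Real.cos_nonneg_of_mem_Icc ⟨by linarith, hθ'⟩
  rw [mem_sectorMinus_iff hθ (by linarith)] at hτ ⊢
  rw [sub_add_eq_add_sub]
  exact norm_lt_rho_sub (by linarith) (by linarith [Real.cos_le_one θ]) hτ ht

theorem sectorMinus_subset_leftRegion {θ r : ℝ} (hθ : 0 ≤ θ) (hθ' : θ ≤ Real.pi / 2)
    (hr : 0 ≤ r) : sectorMinus θ r ⊆ leftRegion (1 - Real.cos θ) ((1 - Real.cos θ) * r) := by
  intro τ hτ
  have hπ := Real.pi_pos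
  have hcos := Real.cos_nonneg_of_mem_Icc ⟨by linarith, hθ'⟩
  have hκ : 0 ≤ 1 - Real.cos θ := by linarith [Real.cos_le_one θ]
  rw [mem_sectorMinus_iff hθ (by linarith)] at hτ
  have h1 := norm_lt_rho_sub (by linarith) hκ hτ hr
  have h2 := rho_add_le_rho_sub (by linarith) hτ.le hr
  rw [add_sub_cancel_right] at h1 h2
  have h3 : 0 ≤ (1 - Real.cos θ) * ‖τ + r‖ := by positivity
  exact ⟨h1, by linarith⟩

/-! ### Existence and uniqueness in the sectors -/

/-- The analogue of `IsParameterization` for an arbitrary vector field `X`, with the equation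
`𝒟Γ = X(Γ)` expressed by the derivative of `Γ` in the direction `(1, 1)`. -/
structure IsSolutionOn (X : Phase → Phase) (U : Set Phase) (h : ℝ) (D : Set ℂ)
    (c : ℕ → ℂ → Phase) (Γ : ℂ × ℂ → Phase) : Prop where
  analytic : AnalyticOnNhd ℂ Γ (strip h ×ˢ D)
  periodic : ∀ φ ∈ strip h, ∀ τ ∈ D, Γ (φ + 2 * Real.pi, τ) = Γ (φ, τ)
  maps_to : MapsTo Γ (strip h ×ˢ D) U
  solves : ∀ x ∈ strip h ×ˢ D, fderiv ℂ Γ x (1, 1) = X (Γ x)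
  expansion : ∀ N, HasExpansionUpTo N (strip h ×ˢ D) Γ c

theorem deriv_add_deriv_eq_fderiv {Γ : ℂ × ℂ → Phase} {φ τ : ℂ}
    (hΓ : DifferentiableAt ℂ Γ (φ, τ)) :
    deriv (fun s => Γ (s, τ)) φ + deriv (fun s => Γ (φ, s)) τ = fderiv ℂ Γ (φ, τ) (1, 1) := by
  have h1 : HasDerivAt (fun s : ℂ => (s, τ)) (1, 0) φ :=
    (hasDerivAt_id φ).prodMk (hasDerivAt_const φ τ)
  have h2 : HasDerivAt (fun s : ℂ => (φ, s)) (0, 1) τ :=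
    (hasDerivAt_const τ φ).prodMk (hasDerivAt_id τ)
  have e1 := (HasFDerivAt.comp_hasDerivAt (l := Γ) φ hΓ.hasFDerivAt h1).deriv
  have e2 := (HasFDerivAt.comp_hasDerivAt (l := Γ) τ hΓ.hasFDerivAt h2).deriv
  simp only [Function.comp_def] at e1 e2
  rw [e1, e2, ← map_add]
  simp

theorem isParameterization_iff {H : Phase → ℂ} {U : Set Phase} {h : ℝ} {D : Set ℂ}
    {c : ℕ → ℂ → Phase} {Γ : ℂ × ℂ → Phase} :
    IsParameterization H U h D c Γ ↔ IsSolutionOn (hamVF H) U h D c Γ := by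
  constructor
  · intro hΓ
    refine ⟨hΓ.analytic, hΓ.periodic, hΓ.maps_to, fun x hx => ?_,
      hasAsymptoticExpansion_iff.1 hΓ.asymptotics⟩
    rw [← hΓ.solves x.1 hx.1 x.2 hx.2]
    exact (deriv_add_deriv_eq_fderiv (hΓ.analytic x hx).differentiableAt).symm
  · intro hΓ
    refine ⟨hΓ.analytic, hΓ.periodic, hΓ.maps_to, fun φ hφ τ hτ => ?_,
      hasAsymptoticExpansion_iff.2 hΓ.expansion⟩
    rw [deriv_add_deriv_eq_fderiv (hΓ.analytic _ ⟨hφ, hτ⟩).differentiableAt]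
    exact hΓ.solves _ ⟨hφ, hτ⟩

/-- Existence and uniqueness in the sector `D⁻`. -/
theorem exists_unique_isSolutionOn_sectorMinus {X : Phase → Phase} {U : Set Phase} (hU : IsOpen U)
    (hU0 : 0 ∈ U) (hXa : AnalyticOnNhd ℂ X U) {ε : ℝ} (hX : IsRotationPerturbation ε X)
    {c : ℕ → ℂ → Phase} (hc : IsAdmissibleCoeff c) {h θ : ℝ} (hres : IsAsymptoticSolution h X c)
    (hθ : 0 < θ) (hθ' : θ ≤ Real.pi / 2) :
    ∃ r > 0, ∃ Γ, IsSolutionOn X U h (sectorMinus θ r) c Γ ∧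
      ∀ Γ', IsSolutionOn X U h (sectorMinus θ r) c Γ' →
        EqOn Γ' Γ (strip h ×ˢ sectorMinus θ r) := by
  have hπ := Real.pi_pos
  have hκ0 : 0 < 1 - Real.cos θ := by
    have := Real.strictAntiOn_cos ⟨le_rfl, hπ.le⟩ ⟨hθ.le, by linarith⟩ hθ
    rw [Real.cos_zero] at this
    linarith
  have hκ : 1 - Real.cos θ ≤ 1 := by
    linarith [Real.cos_nonneg_of_mem_Icc ⟨by linarith, hθ'⟩]
  obtain ⟨R, hR, Γ, hΓa, hΓU, hΓs, hΓe⟩ :=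
    exists_solution_all_orders hU hU0 hXa hX hc hres hκ0 hκ
  obtain ⟨N, huniq⟩ := exists_eqOn_of_hasExpansionUpTo hc hX (h := h) hκ0 hκ
  set r := R / (1 - Real.cos θ) with hr
  have hr0 : 0 < r := by positivity
  set Ω := strip h ×ˢ sectorMinus θ r with hΩ
  have hsub : Ω ⊆ domain h (1 - Real.cos θ) R := by
    refine prod_mono_right ?_
    have := sectorMinus_subset_leftRegion hθ.le hθ' hr0.le
    rwa [hr, mul_div_cancel₀ _ hκ0.ne'] at this
  have hleft : ∀ x ∈ Ω, ∀ t : ℝ, 0 ≤ t → x - diagPt t ∈ Ω := fun x hx t ht =>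
    ⟨sub_mem_strip hx.1 t, sub_mem_sectorMinus hθ.le hθ' hx.2 ht⟩
  have huniq' : ∀ Γ₁ Γ₂ : ℂ × ℂ → Phase, AnalyticOnNhd ℂ Γ₁ Ω → AnalyticOnNhd ℂ Γ₂ Ω →
      (∀ x ∈ Ω, fderiv ℂ Γ₁ x (1, 1) = X (Γ₁ x)) → (∀ x ∈ Ω, fderiv ℂ Γ₂ x (1, 1) = X (Γ₂ x)) →
      HasExpansionUpTo N Ω Γ₁ c → HasExpansionUpTo N Ω Γ₂ c → EqOn Γ₁ Γ₂ Ω := fun Γ₁ Γ₂ =>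
    huniq N le_rfl Ω Γ₁ Γ₂ (fun x hx => ⟨hx.1, (hsub hx).2.1⟩) hleft
  have hΓaΩ := hΓa.mono hsub
  have hΓsΩ := fun x hx => hΓs x (hsub hx)
  have hΓeΩ := fun N => (hΓe N).subset hsub
  refine ⟨r, hr0, Γ, ⟨hΓaΩ, ?_, fun x hx => hΓU (hsub hx), hΓsΩ, hΓeΩ⟩, fun Γ' hΓ' =>
    huniq' Γ' Γ hΓ'.analytic hΓaΩ hΓ'.solves hΓsΩ (hΓ'.expansion N) (hΓeΩ N)⟩
  -- the translate of a solution by a period is a solution with the same expansion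
  let p : ℂ × ℂ := (2 * Real.pi, 0)
  have hp : ∀ x ∈ Ω, x + p ∈ Ω := fun x hx => by
    refine ⟨?_, by simpa [p] using hx.2⟩
    have : |x.1.im| < h := hx.1
    simpa [strip, p] using this
  have htr : ∀ x, trunc c N (x + p) = trunc c N x := fun x => by
    simp [trunc, p, hc.periodic]
  have hper : EqOn (fun x => Γ (x + p)) Γ Ω := by
    refine huniq' _ _ (fun x hx => ?_) hΓaΩ (fun x hx => ?_) hΓsΩ ?_ (hΓeΩ N)
    · exact AnalyticAt.fun_comp (hΓaΩ _ (hp x hx)) (analyticAt_id.fun_add analyticAt_const)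
    · rw [fderiv_comp_add_right]
      exact hΓsΩ _ (hp x hx)
    · obtain ⟨C, hC, P, hP, H⟩ := hΓeΩ N
      refine ⟨C, hC, P, hP, fun x hx hxP => ?_⟩
      have := H _ (hp x hx) (by simpa [p] using hxP)
      rw [htr] at this
      simpa [p] using this
  intro φ hφ τ hτ
  simpa [p] using hper (x := (φ, τ)) ⟨hφ, hτ⟩

/-! ### Reflection -/

/-- The coefficients of the series obtained by the substitution `(φ, τ) ↦ (-φ, -τ)`. -/
def reflectCoeff (c : ℕ → ℂ → Phase) : ℕ → ℂ → Phase := fun k φ => (-1 : ℂ) ^ k • c k (-φ)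

theorem reflectCoeff_reflectCoeff (c : ℕ → ℂ → Phase) : reflectCoeff (reflectCoeff c) = c := by
  ext k φ i
  simp [reflectCoeff, ← mul_assoc, ← mul_pow]

theorem trunc_reflectCoeff (c : ℕ → ℂ → Phase) (N : ℕ) :
    trunc (reflectCoeff c) N = fun x => trunc c N (-x) := by
  ext1 x
  refine Finset.sum_congr rfl fun k _ => ?_
  simp only [reflectCoeff, smul_smul, Prod.fst_neg, Prod.snd_neg]
  rw [neg_pow x.2, mul_inv, mul_comm, ← inv_pow (-1 : ℂ), inv_neg_one]

theorem neg_mem_strip {h : ℝ} {φ : ℂ} (hφ : φ ∈ strip h) : -φ ∈ strip h := by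
  simpa [strip] using hφ

theorem IsAdmissibleCoeff.reflect {c : ℕ → ℂ → Phase} (hc : IsAdmissibleCoeff c) :
    IsAdmissibleCoeff (reflectCoeff c) where
  differentiable k :=
    ((hc.differentiable k).comp differentiable_neg).fun_const_smul ((-1 : ℂ) ^ k)
  periodic k φ := by
    have := hc.periodic k (-(φ + 2 * Real.pi))
    rw [show -(φ + 2 * (Real.pi : ℂ)) + 2 * Real.pi = -φ by ring] at this
    simp only [reflectCoeff, this]
  bounded k h := by
    obtain ⟨B, hB⟩ := hc.bounded k h
    refine ⟨B, fun φ hφ => ?_⟩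
    simpa [reflectCoeff, norm_smul] using hB _ (neg_mem_strip hφ)
  form k i hk φ := by simp [reflectCoeff, hc.form k i hk]

theorem fderiv_comp_neg_apply (f : ℂ × ℂ → Phase) (x v : ℂ × ℂ) :
    fderiv ℂ (fun y => f (-y)) x v = -fderiv ℂ f (-x) v := by
  have := (ContinuousLinearEquiv.neg ℂ (M := ℂ × ℂ)).comp_right_fderiv (f := f) (x := x)
  change fderiv ℂ (f ∘ ContinuousLinearEquiv.neg ℂ (M := ℂ × ℂ)) x v = _
  rw [this]
  exact map_neg (fderiv ℂ f (-x)) v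

theorem IsAsymptoticSolution.reflect {h : ℝ} {X : Phase → Phase} {c : ℕ → ℂ → Phase}
    (hc : IsAsymptoticSolution h X c) : IsAsymptoticSolution h (-X) (reflectCoeff c) := by
  intro N
  obtain ⟨C, hC, R, hR, H⟩ := hc N
  refine ⟨C, hC, R, hR, fun x hx hxR => ?_⟩
  have := H (-x) (neg_mem_strip hx) (by simpa using hxR)
  rw [trunc_reflectCoeff, fderiv_comp_neg_apply, Pi.neg_apply, neg_sub_neg, norm_sub_rev]
  simpa using this

theorem IsSolutionOn.reflect {X : Phase → Phase} {U : Set Phase} {h : ℝ} {D : Set ℂ}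
    {c : ℕ → ℂ → Phase} {Γ : ℂ × ℂ → Phase} (hΓ : IsSolutionOn X U h D c Γ) :
    IsSolutionOn (-X) U h {τ | -τ ∈ D} (reflectCoeff c) (fun x => Γ (-x)) := by
  have hneg : ∀ x ∈ strip h ×ˢ {τ | -τ ∈ D}, -x ∈ strip h ×ˢ D := fun x hx =>
    ⟨neg_mem_strip hx.1, hx.2⟩
  refine ⟨fun x hx => ?_, fun φ hφ τ hτ => ?_, fun x hx => hΓ.maps_to (hneg x hx), fun x hx => ?_,
    fun N => ?_⟩
  · exact AnalyticAt.fun_comp (hΓ.analytic _ (hneg x hx)) analyticAt_id.fun_neg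
  · have hφ' : -(φ + 2 * Real.pi) ∈ strip h := neg_mem_strip (by simpa [strip] using hφ)
    have := hΓ.periodic _ hφ' (-τ) hτ
    rw [show -(φ + 2 * (Real.pi : ℂ)) + 2 * Real.pi = -φ by ring] at this
    exact this.symm
  · rw [fderiv_comp_neg_apply, hΓ.solves _ (hneg x hx), Pi.neg_apply]
  · obtain ⟨C, hC, R, hR, H⟩ := hΓ.expansion N
    refine ⟨C, hC, R, hR, fun x hx hxR => ?_⟩
    rw [trunc_reflectCoeff]
    simpa using H (-x) (hneg x hx) (by simpa using hxR)

theorem theorem2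
    (η : ℂ) (hη : η ≠ 0)
    (U : Set Phase) (hU : IsOpen U) (hU0 : (0 : Phase) ∈ U)
    (F : Phase → ℂ) (hF : AnalyticOnNhd ℂ F U) (hFbdd : ∃ M : ℝ, ∀ x ∈ U, ‖F x‖ ≤ M)
    (hFord : HasWeightedOrderAtLeast 5 F)
    (h θ : ℝ) (hh : 0 < h) (hθ : 0 < θ) (hθ' : θ < Real.pi / 4)
    (Γhat : ℕ → ℂ → Phase) (hΓhat : IsFormalSeparatrix (hamiltonian η F) Γhat) :
    (∃ r > 0, ∃ Γ : ℂ × ℂ → Phase,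
      IsParameterization (hamiltonian η F) U h (sectorMinus θ r) Γhat Γ ∧
      ∀ Γ' : ℂ × ℂ → Phase,
        IsParameterization (hamiltonian η F) U h (sectorMinus θ r) Γhat Γ' →
        EqOn Γ' Γ (strip h ×ˢ sectorMinus θ r)) ∧
    (∃ r > 0, ∃ Γ : ℂ × ℂ → Phase,
      IsParameterization (hamiltonian η F) U h (sectorPlus θ r) Γhat Γ ∧
      ∀ Γ' : ℂ × ℂ → Phase,
        IsParameterization (hamiltonian η F) U h (sectorPlus θ r) Γhat Γ' →
        EqOn Γ' Γ (strip h ×ˢ sectorPlus θ r)) := by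
  have hc := hΓhat.isAdmissibleCoeff
  have hXa : AnalyticOnNhd ℂ (hamVF (hamiltonian η F)) U :=
    analyticOnNhd_hamVF (analyticOnNhd_hamiltonian η hF)
  have hX := isRotationPerturbation_hamVF η (hF 0 hU0) hFord
  have hres : IsAsymptoticSolution h (hamVF (hamiltonian η F)) Γhat :=
    isAsymptoticSolution_of_formalD_eq (hXa 0 hU0) hc hΓhat.solves h
  have hθ2 : θ ≤ Real.pi / 2 := by linarith [Real.pi_pos]
  simp only [isParameterization_iff]
  constructor
  · exact exists_unique_isSolutionOn_sectorMinus hU hU0 hXa (ε := 1) (by simpa using hX) hc hres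
      hθ hθ2
  -- the substitution `(φ, τ) ↦ (-φ, -τ)` exchanges the two sectors
  · obtain ⟨r, hr, Γ, hΓ, huniq⟩ := exists_unique_isSolutionOn_sectorMinus hU hU0 hXa.neg (ε := -1)
      (by simpa using hX.neg) hc.reflect hres.reflect hθ hθ2
    refine ⟨r, hr, fun x => Γ (-x), ?_, fun Γ' hΓ' x hx => ?_⟩
    · have := hΓ.reflect
      rwa [neg_neg, reflectCoeff_reflectCoeff] at this
    · have h1 := hΓ'.reflect
      have e : {τ | -τ ∈ sectorPlus θ r} = sectorMinus θ r := by
        ext τ; simp [sectorPlus]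
      rw [e] at h1
      simpa using huniq _ h1 (x := -x) ⟨neg_mem_strip hx.1, hx.2⟩
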